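/- Let $a=a(n)$ and $k=k(n)$ be sequences of positive integers. In the $(a:b)$ minimum-degree-$k$ game, Breaker and Maker alternately claim previously unclaimed edges of the complete graph $K_n$ until all edges are claimed; in each round Breaker first claims $b$ edges and then Maker claims $a$ edges (a player claims all remaining edges if there are too few). Maker wins if and only if, at the end, the edges he has claimed form a spanning subgraph of $K_n$ with minimum degree at least $k$; otherwise Breaker wins. The threshold bias of this game is the positive integer $b_0=b_0(n)$ such that, for every positive integer $b$, Maker has a winning strategy if $b<b_0$ and Breaker has a winning strategy if $b\ge b_0$. The threshold bias $b_0(n)$ exists, and the following holds as $n\to\infty$. (i) If $a=o\left(\sqrt{n/\ln n}\right)$ and $k=o(\ln n)$, then $b_0(n)=(1+o(1))\,\dfrac{an}{a+\ln n}$. (ii) If $a=\Omega\left(\sqrt{n/\ln n}\right)$, $k=o(a)$ and $k=o(n)$, then $b_0(n)=(1+o(1))\,n$. In particular, with $f(n)=\frac{an}{a+\ln n}$ in case (i) and $f(n)=n$ in case (ii), for every $\varepsilon>0$ and all sufficiently large $n$, Maker has a winning strategy whenever $1\le b\le(1-\varepsilon)f(n)$, and Breaker has one whenever $b\ge(1+\varepsilon)f(n)$.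 -/

import Mathlib

open Filter Asymptotics

namespace MakerBreaker

/-- A move of a player with bias `q` when the set of unclaimed elements is `F`: the player claims
`q` elements of `F` (all of `F`, if fewer than `q` elements are left). -/
def IsLegalMove {α : Type*} (q : ℕ) (F S : Finset α) : Prop :=
  S ⊆ F ∧ S.card = min q F.card

/-- The history of a game at the beginning of a round: the list of the completed rounds, the most
recent one first. A round is a pair (elements claimed by Breaker, elements claimed by Maker). -/
abbrev History (α : Type*) := List (Finset α × Finset α)

/-- The elements claimed by Maker in a history. -/
def History.maker {α : Type*} [DecidableEq α] : History α → Finset α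
  | [] => ∅
  | r :: h => r.2 ∪ History.maker h

/-- The elements claimed by Breaker in a history. -/
def History.breaker {α : Type*} [DecidableEq α] : History α → Finset α
  | [] => ∅
  | r :: h => r.1 ∪ History.breaker h

/-- The elements of the board `X` that nobody has claimed in the history `h`. -/
def unclaimed {α : Type*} [DecidableEq α] (X : Finset α) (h : History α) : Finset α :=
  X \ (h.maker ∪ h.breaker)

/-- A strategy of Breaker with bias `b` on the board `X`: a legal move for each history. -/
structure BreakerStrategy {α : Type*} [DecidableEq α] (X : Finset α) (b : ℕ) where
  move : History α → Finset α
  legal : ∀ h, IsLegalMove b (unclaimed X h) (move h)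

/-- A strategy of Maker with bias `a` on the board `X`: a legal move for each history and each
move `S` by which Breaker has opened the current round. -/
structure MakerStrategy {α : Type*} [DecidableEq α] (X : Finset α) (a : ℕ) where
  move : History α → Finset α → Finset α
  legal : ∀ h S, IsLegalMove a (unclaimed X h \ S) (move h S)

/-- The history after `t` rounds if Breaker plays `σ` and Maker plays `τ`. In each round Breaker
moves first. Once the board is exhausted all further moves are empty. -/
def play {α : Type*} [DecidableEq α] {X : Finset α} {a b : ℕ}
    (σ : BreakerStrategy X b) (τ : MakerStrategy X a) : ℕ → History α
  | 0 => []
  | t + 1 =>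
    (σ.move (play σ τ t), τ.move (play σ τ t) (σ.move (play σ τ t))) :: play σ τ t

/-- Maker wins the play of `σ` against `τ`: at some time, equivalently at the end of the game, he
has claimed all elements of some winning set. Otherwise Breaker wins the play. -/
def MakerWinsPlay {α : Type*} [DecidableEq α] {X : Finset α} (𝓕 : Set (Finset α)) {a b : ℕ}
    (σ : BreakerStrategy X b) (τ : MakerStrategy X a) : Prop :=
  ∃ t : ℕ, ∃ W ∈ 𝓕, W ⊆ (play σ τ t).maker

/-- Maker has a winning strategy in the `(a : b)` game on the board `X` with winning sets `𝓕`. -/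
def MakerWins {α : Type*} [DecidableEq α] (X : Finset α) (𝓕 : Set (Finset α)) (a b : ℕ) : Prop :=
  ∃ τ : MakerStrategy X a, ∀ σ : BreakerStrategy X b, MakerWinsPlay 𝓕 σ τ

/-- Breaker has a winning strategy in the `(a : b)` game on the board `X` with winning sets `𝓕`. -/
def BreakerWins {α : Type*} [DecidableEq α] (X : Finset α) (𝓕 : Set (Finset α)) (a b : ℕ) : Prop :=
  ∃ σ : BreakerStrategy X b, ∀ τ : MakerStrategy X a, ¬ MakerWinsPlay 𝓕 σ τ

/-- The positive integer `b₀` is the threshold bias of the game on the board `X` with winning sets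
`𝓕`, for Maker's bias `a`: for all positive `b`, Maker has a winning strategy in the `(a : b)` game
if `b < b₀`, and Breaker has one if `b ≥ b₀`. -/
def IsThresholdBias {α : Type*} [DecidableEq α] (X : Finset α) (𝓕 : Set (Finset α))
    (a b₀ : ℕ) : Prop :=
  1 ≤ b₀ ∧ ∀ b : ℕ, 1 ≤ b →
    (b < b₀ → MakerWins X 𝓕 a b) ∧ (b₀ ≤ b → BreakerWins X 𝓕 a b)

/-- The edge set of the complete graph on `n` vertices. -/
def completeEdges (n : ℕ) : Finset (Sym2 (Fin n)) :=
  (⊤ : SimpleGraph (Fin n)).edgeFinset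

open Classical in
/-- The edge sets of the spanning subgraphs of `K_n` with minimum degree at least `k`. -/
def minDegreeSets (n k : ℕ) : Set (Finset (Sym2 (Fin n))) :=
  {W | W ⊆ completeEdges n ∧
    k ≤ (SimpleGraph.fromEdgeSet (W : Set (Sym2 (Fin n)))).minDegree}

/-- The asymptotic threshold bias of the `(a : b)` minimum-degree-`k` game on `K_n`, where
`a = a(n)` and `k = k(n)`, is `f(n)`: the threshold bias `b₀(n)` exists for every `n`, and
`b₀(n) = (1 + o(1)) f(n)`. -/
def IsAsymptoticThresholdBias (a k : ℕ → ℕ) (f : ℕ → ℝ) : Prop :=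
  ∃ b₀ : ℕ → ℕ,
    (∀ n, IsThresholdBias (completeEdges n) (minDegreeSets n (k n)) (a n) (b₀ n)) ∧
    (fun n => (b₀ n : ℝ)) ~[atTop] f

end MakerBreaker

namespace MakerBreaker

/-! ### Determinacy, monotonicity and existence of the threshold bias -/

section Positional

/-! The board is finite, so the game is determined, and a smaller bias of Breaker never hurts Maker.
This gives a threshold (`exists_isThresholdBias`). Its asymptotics then need only a strategy for
each player on either side of `f`, with relative error `ε` (`isAsymptoticThresholdBias_of_forall`).

Maker (`makerWins_minDegree`) gives each vertex the danger `deg_B - 2β deg_M`, where `β = b / a`,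
and keeps claiming an edge at a most dangerous vertex of degree below `k`. The invariant bounds the
total danger of every set `J` of such vertices. Easing a vertex of maximal danger either lowers the
sum over `J` directly, or lets `J` be compared with `J` plus that vertex by averaging
(`DangerBound.ease`), so bounds for large sets pass to smaller ones at a harmonic cost. A round of
Breaker adds up to `2b` to a sum, which alone would give `2β log n`. For sets of at most `m`
vertices the edges inside are discounted, a round then adds only `b`, and the cost is `β log m` plus
`m` for the discount. With `m ≈ n / log n` the danger of a single vertex stays below about `β log
n`, so no vertex in need runs out of free edges as long as `β (a + log n) < (1 - ε) n`.

Breaker (`breakerWins_minDegree`) isolates a vertex. He builds a clique on `a * q` vertices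
untouched by Maker; an edge of Maker can then spoil at most one of them. Next he raises his degree
evenly on the surviving vertices while Maker spoils `a` per round. The gains `b / (a j)` sum to
about `(b / a) log q`, and a last move adds `b`. With `q ≈ n / log³ n` this reaches `n` once `b (a +
log n)` exceeds `(1 + ε) a n`. For `a` at least of order `log n / ε`, such a `b` is at least `n` and
one move suffices.

In the second regime `log n = o(a)`, so the same formula is asymptotic to `n`. -/

theorem exists_isLegalMove_superset {α : Type*} {q : ℕ} {F S : Finset α} (hS : S ⊆ F) (hq : S.card ≤ q) :
    ∃ T, S ⊆ T ∧ IsLegalMove q F T := by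
  obtain ⟨T, h1, h2, h3⟩ := Finset.exists_subsuperset_card_eq hS (n := min q F.card)
    (le_min hq (Finset.card_le_card hS)) (min_le_right _ _)
  exact ⟨T, h1, h2, h3⟩

theorem exists_isLegalMove {α : Type*} (q : ℕ) (F : Finset α) : ∃ T, IsLegalMove q F T := by
  obtain ⟨T, -, hT⟩ := exists_isLegalMove_superset (Finset.empty_subset F) (q := q) (by simp)
  exact ⟨T, hT⟩

variable {α : Type*} [DecidableEq α]

/-- Maker, to whom `M` belongs while `B` belongs to Breaker, can fill a winning set within the
next `t` rounds. -/
def WinsWithin (X : Finset α) (𝓕 : Set (Finset α)) (a b : ℕ) :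
    ℕ → Finset α → Finset α → Prop
  | 0, M, _ => ∃ W ∈ 𝓕, W ⊆ M
  | t + 1, M, B => ∀ S, IsLegalMove b (X \ (M ∪ B)) S →
      ∃ T, IsLegalMove a ((X \ (M ∪ B)) \ S) T ∧ WinsWithin X 𝓕 a b t (T ∪ M) (S ∪ B)

/-- Breaker can prevent Maker from ever filling a winning set. -/
def BreakerHolds (X : Finset α) (𝓕 : Set (Finset α)) (a b : ℕ) (M B : Finset α) : Prop :=
  ∀ t, ¬ WinsWithin X 𝓕 a b t M B

variable {X : Finset α} {𝓕 : Set (Finset α)} {a b : ℕ}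

theorem winsWithin_of_subset {t : ℕ} : ∀ {M B : Finset α}, (∃ W ∈ 𝓕, W ⊆ M) →
    WinsWithin X 𝓕 a b t M B := by
  induction t with
  | zero => intro M B h; exact h
  | succ t ih =>
    rintro M B ⟨W, hW, hWM⟩ S -
    obtain ⟨T, hT⟩ := exists_isLegalMove a ((X \ (M ∪ B)) \ S)
    exact ⟨T, hT, ih ⟨W, hW, hWM.trans Finset.subset_union_right⟩⟩

theorem WinsWithin.mono {s t : ℕ} (hst : s ≤ t) {M B : Finset α}
    (h : WinsWithin X 𝓕 a b s M B) : WinsWithin X 𝓕 a b t M B := by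
  induction s generalizing t M B with
  | zero => exact winsWithin_of_subset h
  | succ s ih =>
    obtain ⟨t, rfl⟩ : ∃ u, t = u + 1 := ⟨t - 1, by omega⟩
    intro S hS
    obtain ⟨T, hT, hw⟩ := h S hS
    exact ⟨T, hT, ih (by omega) hw⟩

/-- A smaller bias of Breaker and a better position are of advantage to Maker. -/
theorem WinsWithin.of_le {b' : ℕ} (hb : b ≤ b') {t : ℕ} {M M' B B' : Finset α}
    (hM : M ⊆ M') (hB : B' ⊆ B) (h : WinsWithin X 𝓕 a b' t M B) :
    WinsWithin X 𝓕 a b t M' B' := by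
  induction t generalizing M M' B B' with
  | zero =>
    obtain ⟨W, hW, hWM⟩ := h
    exact ⟨W, hW, hWM.trans hM⟩
  | succ t ih =>
    rintro S ⟨hSF, hSc⟩
    have hSB : S \ B ⊆ X \ (M ∪ B) := by
      intro x hx
      have hxS := Finset.mem_sdiff.1 hx
      have := Finset.mem_sdiff.1 (hSF hxS.1)
      simp only [Finset.mem_union, not_or, Finset.mem_sdiff] at this ⊢
      exact ⟨this.1, fun h => this.2.1 (hM h), hxS.2⟩
    -- Maker simulates the harder game: Breaker's move is padded to a legal one there, and the
    -- simulated reply, minus what Maker already owns, is padded back.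
    obtain ⟨S', hSS', hS'⟩ := exists_isLegalMove_superset hSB (q := b')
      ((Finset.card_le_card Finset.sdiff_subset).trans
        ((hSc.trans_le (min_le_left _ _)).trans hb))
    obtain ⟨T', hT', hw⟩ := h S' hS'
    have hTF : T' \ M' ⊆ (X \ (M' ∪ B')) \ S := by
      intro x hx
      have hxT := Finset.mem_sdiff.1 hx
      have := hT'.1 hxT.1
      simp only [Finset.mem_union, not_or, Finset.mem_sdiff] at this ⊢
      refine ⟨⟨this.1.1, hxT.2, fun h => this.1.2.2 (hB h)⟩, fun hxS => this.2 (hSS' ?_)⟩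
      exact Finset.mem_sdiff.2 ⟨hxS, this.1.2.2⟩
    obtain ⟨T, hTT, hT⟩ := exists_isLegalMove_superset hTF (q := a)
      ((Finset.card_le_card Finset.sdiff_subset).trans (hT'.2.trans_le (min_le_left _ _)))
    refine ⟨T, hT, ih ?_ ?_ hw⟩
    · intro x hx
      by_cases hxM : x ∈ M'
      · exact Finset.mem_union_right _ hxM
      · rcases Finset.mem_union.1 hx with h | h
        · exact Finset.mem_union_left _ (hTT (Finset.mem_sdiff.2 ⟨h, hxM⟩))
        · exact absurd (hM h) hxM
    · intro x hx
      by_cases hxB : x ∈ B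
      · exact Finset.mem_union_right _ hxB
      · rcases Finset.mem_union.1 hx with h | h
        · exact Finset.mem_union_left _ (hSS' (Finset.mem_sdiff.2 ⟨h, hxB⟩))
        · exact absurd (hB h) hxB

theorem length_play (σ : BreakerStrategy X b) (τ : MakerStrategy X a) (t : ℕ) :
    (play σ τ t).length = t := by
  induction t with
  | zero => rfl
  | succ t ih => simp [play, ih]

open Classical in
theorem makerWins_of_winsWithin {N : ℕ} (h : WinsWithin X 𝓕 a b N ∅ ∅) :
    MakerWins X 𝓕 a b := by
  -- Stated as an implication so that a legal move is chosen at every history, reachable or not. The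
  -- number of rounds left is read off from the length of the history.
  have key : ∀ (h : History α) (S : Finset α), ∃ T, IsLegalMove a (unclaimed X h \ S) T ∧
      ((∃ T, IsLegalMove a (unclaimed X h \ S) T ∧
        WinsWithin X 𝓕 a b (N - h.length - 1) (T ∪ h.maker) (S ∪ h.breaker)) →
        WinsWithin X 𝓕 a b (N - h.length - 1) (T ∪ h.maker) (S ∪ h.breaker)) := by
    intro h S
    by_cases hx : ∃ T, IsLegalMove a (unclaimed X h \ S) T ∧
        WinsWithin X 𝓕 a b (N - h.length - 1) (T ∪ h.maker) (S ∪ h.breaker)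
    · obtain ⟨T, hT, hw⟩ := hx
      exact ⟨T, hT, fun _ => hw⟩
    · obtain ⟨T, hT⟩ := exists_isLegalMove a (unclaimed X h \ S)
      exact ⟨T, hT, fun h => absurd h hx⟩
  choose f hf hfw using key
  refine ⟨⟨f, hf⟩, fun σ => ?_⟩
  have hplay : ∀ t ≤ N, WinsWithin X 𝓕 a b (N - t) (play σ ⟨f, hf⟩ t).maker
      (play σ ⟨f, hf⟩ t).breaker := by
    intro t
    induction t with
    | zero => intro _; exact h
    | succ t ih =>
      intro ht
      have hw := ih (by omega)
      obtain ⟨u, hu⟩ : ∃ u, N - t = u + 1 := ⟨N - t - 1, by omega⟩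
      rw [hu] at hw
      have hu' : N - (t + 1) = N - (play σ ⟨f, hf⟩ t).length - 1 := by
        rw [length_play]; omega
      rw [hu']
      refine hfw (play σ ⟨f, hf⟩ t) (σ.move (play σ ⟨f, hf⟩ t)) ?_
      obtain ⟨T, hT, hTw⟩ := hw _ (σ.legal (play σ ⟨f, hf⟩ t))
      refine ⟨T, hT, ?_⟩
      rw [length_play, hu]
      exact hTw
  have := hplay N le_rfl
  rw [Nat.sub_self] at this
  exact ⟨N, this⟩

/-- This is where finiteness enters: if every legal move of Breaker lost, each within its own number
of rounds, the maximum over the finitely many moves would be a common horizon. -/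
theorem BreakerHolds.exists_move {M B : Finset α} (h : BreakerHolds X 𝓕 a b M B) :
    ∃ S, IsLegalMove b (X \ (M ∪ B)) S ∧ ∀ T, IsLegalMove a ((X \ (M ∪ B)) \ S) T →
      BreakerHolds X 𝓕 a b (T ∪ M) (S ∪ B) := by
  by_contra! hcon
  have key : ∀ S, ∃ t, IsLegalMove b (X \ (M ∪ B)) S →
      ∃ T, IsLegalMove a ((X \ (M ∪ B)) \ S) T ∧ WinsWithin X 𝓕 a b t (T ∪ M) (S ∪ B) := by
    intro S
    by_cases hS : IsLegalMove b (X \ (M ∪ B)) S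
    · obtain ⟨T, hT, hw⟩ := hcon S hS
      simp only [BreakerHolds, not_forall, not_not] at hw
      obtain ⟨t, ht⟩ := hw
      exact ⟨t, fun _ => ⟨T, hT, ht⟩⟩
    · exact ⟨0, fun h => absurd h hS⟩
  choose f hf using key
  refine h ((X \ (M ∪ B)).powerset.sup f + 1) fun S hS => ?_
  obtain ⟨T, hT, hw⟩ := hf S hS
  exact ⟨T, hT, hw.mono (Finset.le_sup (f := f) (Finset.mem_powerset.2 hS.1))⟩

theorem BreakerHolds.of_move {M B S : Finset α} (hS : IsLegalMove b (X \ (M ∪ B)) S)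
    (h : ∀ T, IsLegalMove a ((X \ (M ∪ B)) \ S) T → BreakerHolds X 𝓕 a b (T ∪ M) (S ∪ B)) :
    BreakerHolds X 𝓕 a b M B := by
  intro t hw
  obtain ⟨T, hT, hTw⟩ := hw.mono (Nat.le_succ t) S hS
  exact h T hT t hTw

open Classical in
theorem breakerWins_of_breakerHolds (h : BreakerHolds X 𝓕 a b ∅ ∅) :
    BreakerWins X 𝓕 a b := by
  have key : ∀ h : History α, ∃ S, IsLegalMove b (unclaimed X h) S ∧
      (BreakerHolds X 𝓕 a b h.maker h.breaker → ∀ T, IsLegalMove a (unclaimed X h \ S) T →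
        BreakerHolds X 𝓕 a b (T ∪ h.maker) (S ∪ h.breaker)) := by
    intro h
    by_cases hx : BreakerHolds X 𝓕 a b h.maker h.breaker
    · obtain ⟨S, hS, hw⟩ := hx.exists_move
      exact ⟨S, hS, fun _ => hw⟩
    · obtain ⟨S, hS⟩ := exists_isLegalMove b (unclaimed X h)
      exact ⟨S, hS, fun h => absurd h hx⟩
  choose f hf hfw using key
  refine ⟨⟨f, hf⟩, fun τ => ?_⟩
  have hplay : ∀ t, BreakerHolds X 𝓕 a b (play ⟨f, hf⟩ τ t).maker
      (play ⟨f, hf⟩ τ t).breaker := by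
    intro t
    induction t with
    | zero => exact h
    | succ t ih => exact hfw _ ih _ (τ.legal _ _)
  rintro ⟨t, ht⟩
  exact hplay t 0 ht

theorem makerWins_or_breakerWins : MakerWins X 𝓕 a b ∨ BreakerWins X 𝓕 a b := by
  by_cases h : BreakerHolds X 𝓕 a b ∅ ∅
  · exact Or.inr (breakerWins_of_breakerHolds h)
  · simp only [BreakerHolds, not_forall, not_not] at h
    obtain ⟨t, ht⟩ := h
    exact Or.inl (makerWins_of_winsWithin ht)

theorem MakerWins.not_breakerWins (h : MakerWins X 𝓕 a b) : ¬ BreakerWins X 𝓕 a b := by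
  obtain ⟨τ, hτ⟩ := h
  rintro ⟨σ, hσ⟩
  exact hσ τ (hτ σ)

/-- Determinacy turns a strategy into a uniform horizon, so that `WinsWithin.of_le` can compare
biases. -/
theorem MakerWins.exists_winsWithin (h : MakerWins X 𝓕 a b) :
    ∃ t, WinsWithin X 𝓕 a b t ∅ ∅ := by
  by_contra! hcon
  exact h.not_breakerWins (breakerWins_of_breakerHolds hcon)

theorem MakerWins.of_le {b' : ℕ} (hb : b ≤ b') (h : MakerWins X 𝓕 a b') :
    MakerWins X 𝓕 a b := by
  obtain ⟨t, ht⟩ := h.exists_winsWithin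
  exact makerWins_of_winsWithin (ht.of_le hb (Finset.Subset.refl _) (Finset.Subset.refl _))

/-- If every winning set is nonempty, then Breaker wins by claiming the whole board at once. -/
theorem breakerWins_of_card_le (hF : ∅ ∉ 𝓕) (hb : X.card ≤ b) : BreakerWins X 𝓕 a b := by
  apply breakerWins_of_breakerHolds
  have hold : ∀ t, ¬ WinsWithin X 𝓕 a b t ∅ X := by
    intro t
    induction t with
    | zero =>
      rintro ⟨W, hW, hW0⟩
      rw [Finset.subset_empty.1 hW0] at hW
      exact hF hW
    | succ t ih =>
      intro hw
      obtain ⟨S, hS⟩ := exists_isLegalMove b (X \ (∅ ∪ X))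
      obtain ⟨T, hT, hTw⟩ := hw S hS
      have hS0 : S = ∅ := by have := hS.1; simpa using this
      have hT0 : T = ∅ := by have := hT.1; simpa [hS0] using this
      rw [hS0, hT0] at hTw
      simp only [Finset.empty_union] at hTw
      exact ih hTw
  refine BreakerHolds.of_move (S := X) ⟨by simp, by simpa using hb⟩ fun T hT => ?_
  have hT0 : T = ∅ := by have := hT.1; simpa using this
  rw [hT0]
  simp only [Finset.union_empty]
  exact hold

theorem exists_isThresholdBias (hF : ∅ ∉ 𝓕) : ∃ b₀, IsThresholdBias X 𝓕 a b₀ := by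
  classical
  have hex : ∃ b, 1 ≤ b ∧ ¬ MakerWins X 𝓕 a b :=
    -- The added `1` keeps the bias positive on an empty board.
    ⟨X.card + 1, by omega, fun h => h.not_breakerWins (breakerWins_of_card_le hF (by omega))⟩
  refine ⟨Nat.find hex, (Nat.find_spec hex).1, fun b hb => ⟨fun hlt => ?_, fun hle => ?_⟩⟩
  · by_contra hcon
    exact Nat.find_min hex hlt ⟨hb, hcon⟩
  · rcases makerWins_or_breakerWins (X := X) (𝓕 := 𝓕) (a := a) (b := b) with h | h
    · exact absurd (h.of_le hle) (Nat.find_spec hex).2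
    · exact h

/-- Maker wins if he can maintain an invariant under which the exhausted board is won. -/
theorem makerWins_of_invariant (ha : 1 ≤ a) (P : Finset α → Finset α → Prop) (h0 : P ∅ ∅)
    (hstep : ∀ M B S, M ⊆ X → P M B → IsLegalMove b (X \ (M ∪ B)) S →
      ∃ T, IsLegalMove a ((X \ (M ∪ B)) \ S) T ∧ P (T ∪ M) (S ∪ B))
    (hend : ∀ M B, M ⊆ X → P M B → X ⊆ M ∪ B → ∃ W ∈ 𝓕, W ⊆ M) : MakerWins X 𝓕 a b := by
  -- The number of unclaimed elements serves as horizon: as `a ≥ 1`, it drops in each round until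
  -- the board is exhausted.
  have key : ∀ N : ℕ, ∀ M B, (X \ (M ∪ B)).card ≤ N → M ⊆ X → P M B →
      WinsWithin X 𝓕 a b N M B := by
    intro N
    induction N with
    | zero =>
      intro M B hc hM hP
      exact hend M B hM hP (Finset.sdiff_eq_empty_iff_subset.1 (Finset.card_eq_zero.1 (by omega)))
    | succ N ih =>
      intro M B hc hM hP S hS
      obtain ⟨T, hT, hP'⟩ := hstep M B S hM hP hS
      refine ⟨T, hT, ih _ _ ?_ (Finset.union_subset ?_ hM) hP'⟩
      · have h1 : X \ (T ∪ M ∪ (S ∪ B)) ⊆ ((X \ (M ∪ B)) \ S) \ T := by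
          intro x hx
          simp only [Finset.mem_sdiff, Finset.mem_union, not_or] at hx ⊢
          tauto
        have h2 := Finset.card_le_card h1
        rw [Finset.card_sdiff_of_subset hT.1, hT.2] at h2
        have h3 : ((X \ (M ∪ B)) \ S).card ≤ (X \ (M ∪ B)).card :=
          Finset.card_le_card Finset.sdiff_subset
        omega
      · exact hT.1.trans (Finset.sdiff_subset.trans Finset.sdiff_subset)
  exact makerWins_of_winsWithin (key _ ∅ ∅ le_rfl (Finset.empty_subset _) h0)

end Positional

/-! ### Counting edges at vertices and inside vertex sets -/

section Degrees

variable {V : Type*} [DecidableEq V]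

/-- The number of edges in `E` at the vertex `v`. -/
def degreeIn (E : Finset (Sym2 V)) (v : V) : ℕ := (E.filter (v ∈ ·)).card

/-- The number of edges in `E` with both ends in `J`. -/
def insideCount (E : Finset (Sym2 V)) (J : Finset V) : ℕ := (E.filter (· ∈ J.sym2)).card

theorem degreeIn_mono {E E' : Finset (Sym2 V)} (h : E ⊆ E') (v : V) :
    degreeIn E v ≤ degreeIn E' v :=
  Finset.card_le_card (Finset.filter_subset_filter _ h)

theorem degreeIn_union_le (E E' : Finset (Sym2 V)) (v : V) :
    degreeIn (E ∪ E') v ≤ degreeIn E v + degreeIn E' v := by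
  unfold degreeIn
  rw [Finset.filter_union]
  exact Finset.card_union_le _ _

theorem degreeIn_insert_of_mem {E : Finset (Sym2 V)} {e : Sym2 V} {v : V} (he : e ∉ E)
    (hv : v ∈ e) : degreeIn (insert e E) v = degreeIn E v + 1 := by
  unfold degreeIn
  rw [Finset.filter_insert, if_pos hv, Finset.card_insert_of_notMem (by simp [he])]

theorem insideCount_union {E E' : Finset (Sym2 V)} (h : Disjoint E E') (J : Finset V) :
    insideCount (E ∪ E') J = insideCount E J + insideCount E' J := by
  unfold insideCount
  rw [Finset.filter_union, Finset.card_union_of_disjoint]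
  exact Finset.disjoint_filter_filter h

theorem insideCount_le_card (E : Finset (Sym2 V)) (J : Finset V) : insideCount E J ≤ E.card :=
  Finset.card_filter_le _ _

theorem card_filter_mem_le (J : Finset V) (e : Sym2 V) :
    (J.filter (· ∈ e)).card ≤ 1 + if e ∈ J.sym2 then 1 else 0 := by
  induction e using Sym2.ind with
  | _ x y =>
    have hsub : J.filter (· ∈ s(x, y)) ⊆ {x, y} := by
      intro v hv
      simpa using (Finset.mem_filter.1 hv).2
    split_ifs with h
    · exact (Finset.card_le_card hsub).trans Finset.card_le_two
    · rw [Finset.mk_mem_sym2_iff, not_and_or] at h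
      rw [add_zero, Finset.card_le_one]
      intro u hu v hv
      have hu' := hsub hu
      have hv' := hsub hv
      simp only [Finset.mem_insert, Finset.mem_singleton] at hu' hv'
      have huJ := (Finset.mem_filter.1 hu).1
      have hvJ := (Finset.mem_filter.1 hv).1
      rcases hu' with rfl | rfl <;> rcases hv' with rfl | rfl <;> tauto

/-- Double counting: only an edge inside `J` counts twice. Keeping the inside edges apart is what
makes the discount for small sets possible. -/
theorem sum_degreeIn_le (E : Finset (Sym2 V)) (J : Finset V) :
    ∑ v ∈ J, degreeIn E v ≤ E.card + insideCount E J := by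
  have h : ∑ v ∈ J, degreeIn E v = ∑ e ∈ E, (J.filter (· ∈ e)).card := by
    simp only [degreeIn, Finset.card_filter]
    exact Finset.sum_comm
  rw [h, insideCount, Finset.card_filter, Finset.card_eq_sum_ones, ← Finset.sum_add_distrib]
  exact Finset.sum_le_sum fun e _ => card_filter_mem_le J e

/-- Without loops, every new inside edge joins `v` to a vertex of `J`. This bounds the loss of
discount when `J` is compared with `insert v J`. -/
theorem insideCount_insert_le {E : Finset (Sym2 V)} (hE : ∀ e ∈ E, ¬ e.IsDiag) (J : Finset V)
    (v : V) : insideCount E (insert v J) ≤ insideCount E J + J.card := by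
  have hsub : E.filter (· ∈ (insert v J).sym2) ⊆
      E.filter (· ∈ J.sym2) ∪ J.image (fun u => s(v, u)) := by
    intro e he
    obtain ⟨heE, heJ⟩ := Finset.mem_filter.1 he
    have hd := hE e heE
    clear he
    induction e using Sym2.ind with
    | _ x y =>
      simp only [Finset.mk_mem_sym2_iff, Finset.mem_insert, Sym2.mk_isDiag_iff] at heJ hd
      simp only [Finset.mem_union, Finset.mem_filter, Finset.mk_mem_sym2_iff, Finset.mem_image]
      rcases heJ with ⟨rfl | hx, rfl | hy⟩
      · exact absurd rfl hd
      · exact Or.inr ⟨y, hy, rfl⟩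
      · exact Or.inr ⟨x, hx, Sym2.eq_swap⟩
      · exact Or.inl ⟨heE, hx, hy⟩
  exact (Finset.card_le_card hsub).trans ((Finset.card_union_le _ _).trans
    (Nat.add_le_add_left Finset.card_image_le _))

end Degrees

/-! ### Winning sets in terms of degrees in the complete graph -/

section CompleteGraph

variable {n : ℕ}

theorem mk_mem_completeEdges {u v : Fin n} : s(u, v) ∈ completeEdges n ↔ u ≠ v := by
  simp [completeEdges]

theorem not_isDiag_of_mem_completeEdges {e : Sym2 (Fin n)} (he : e ∈ completeEdges n) :
    ¬ e.IsDiag := by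
  induction e using Sym2.ind with
  | _ x y => simpa using mk_mem_completeEdges.1 he

theorem degreeIn_completeEdges (v : Fin n) : degreeIn (completeEdges n) v = n - 1 := by
  have h := SimpleGraph.complete_graph_degree (V := Fin n) v
  rw [← SimpleGraph.card_incidenceFinset_eq_degree, SimpleGraph.incidenceFinset_eq_filter] at h
  simpa [degreeIn, completeEdges] using h

open Classical in
theorem degree_fromEdgeSet {W : Finset (Sym2 (Fin n))} (hW : W ⊆ completeEdges n) (v : Fin n) :
    (SimpleGraph.fromEdgeSet (W : Set (Sym2 (Fin n)))).degree v = degreeIn W v := by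
  rw [← SimpleGraph.card_incidenceFinset_eq_degree, SimpleGraph.incidenceFinset_eq_filter,
    degreeIn]
  congr 1
  ext e
  simp only [Finset.mem_filter, SimpleGraph.mem_edgeFinset, SimpleGraph.edgeSet_fromEdgeSet,
    Set.mem_sdiff, Finset.mem_coe]
  constructor
  · rintro ⟨⟨h1, -⟩, h2⟩
    exact ⟨h1, h2⟩
  · rintro ⟨h1, h2⟩
    exact ⟨⟨h1, not_isDiag_of_mem_completeEdges (hW h1)⟩, h2⟩

theorem mem_minDegreeSets [NeZero n] {k : ℕ} {W : Finset (Sym2 (Fin n))}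
    (hW : W ⊆ completeEdges n) : W ∈ minDegreeSets n k ↔ ∀ v, k ≤ degreeIn W v := by
  classical
  have : W ∈ minDegreeSets n k ↔
      k ≤ (SimpleGraph.fromEdgeSet (W : Set (Sym2 (Fin n)))).minDegree := by
    simp only [minDegreeSets, Set.mem_ofPred_eq, hW, true_and]
  rw [this]
  constructor
  · intro h v
    rw [← degree_fromEdgeSet hW]
    exact h.trans (SimpleGraph.minDegree_le_degree _ v)
  · intro h
    refine SimpleGraph.le_minDegree_of_forall_le_degree _ _ fun v => ?_
    rw [degree_fromEdgeSet hW]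
    exact h v

theorem empty_notMem_minDegreeSets {k : ℕ} (hk : 1 ≤ k) : ∅ ∉ minDegreeSets n k := by
  rcases Nat.eq_zero_or_pos n with rfl | hn
  · rintro ⟨-, h⟩
    rw [SimpleGraph.minDegree_of_subsingleton] at h
    omega
  · have : NeZero n := ⟨hn.ne'⟩
    intro h
    have := (mem_minDegreeSets (Finset.empty_subset _)).1 h 0
    simp [degreeIn] at this
    omega

theorem exists_free_edge {M B : Finset (Sym2 (Fin n))} {v : Fin n}
    (h : degreeIn M v + degreeIn B v < n - 1) :
    ∃ e ∈ completeEdges n \ (M ∪ B), v ∈ e := by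
  by_contra! hcon
  have hsub : (completeEdges n).filter (v ∈ ·) ⊆ (M ∪ B).filter (v ∈ ·) := by
    intro e he
    obtain ⟨heX, hve⟩ := Finset.mem_filter.1 he
    refine Finset.mem_filter.2 ⟨?_, hve⟩
    by_contra hMB
    exact hcon e (Finset.mem_sdiff.2 ⟨heX, hMB⟩) hve
  have h1 := Finset.card_le_card hsub
  have h2 := degreeIn_union_le M B v
  have h3 := degreeIn_completeEdges v
  unfold degreeIn at *
  omega

end CompleteGraph

/-! ### The danger potential -/

section Danger

variable {V : Type*} [DecidableEq V]

/-- An upper bound for the total danger of all sets `J` of active vertices when Maker has `r` more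
edges to claim in the current round. For sets of at most `m` vertices, the number `e J` of the
edges inside `J` is discounted. -/
def DangerBound (β : ℝ) (G R : ℕ → ℝ) (m : ℕ) (e : Finset V → ℝ) (r : ℕ) (A : Finset V)
    (d : V → ℝ) : Prop :=
  ∀ J ⊆ A, J.Nonempty → ∑ v ∈ J, d v ≤ J.card * G J.card + 2 * β * r ∧
    (J.card ≤ m → ∑ v ∈ J, d v - e J ≤ J.card * R J.card + β * r)

/-- The bound improves when Maker eases a vertex of the largest danger. -/
theorem DangerBound.ease [Fintype V] {β : ℝ} {G R : ℕ → ℝ} {m r : ℕ} {e : Finset V → ℝ}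
    {A A' : Finset V} {d d' : V → ℝ} {v : V} (h : DangerBound β G R m e (r + 1) A d)
    (hβ : 0 ≤ β)
    (hG : ∀ j : ℕ, 1 ≤ j → j < Fintype.card V → G (j + 1) + 2 * β / (j + 1) ≤ G j)
    (hR : ∀ j : ℕ, 1 ≤ j → j < m → R (j + 1) + β / (j + 1) + 1 ≤ R j)
    (hm : m * G m + β * r ≤ m * R m) (he0 : ∀ J, 0 ≤ e J)
    (he : ∀ J v, v ∉ J → e (insert v J) ≤ e J + J.card)
    (hA : A' ⊆ A) (hd : ∀ u, d' u ≤ d u) (hvA : v ∈ A) (hmax : ∀ u ∈ A, d u ≤ d v)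
    (hv : d' v ≤ d v - 2 * β) : DangerBound β G R m e r A' d' := by
  intro J hJ hne
  have hsum : ∑ u ∈ J, d' u ≤ ∑ u ∈ J, d u := Finset.sum_le_sum fun u _ => hd u
  -- If `v ∈ J`, the drop by `2β` pays for the edge just used. Otherwise the average danger over `J`
  -- is at most that over `insert v J`, and the bound for the larger set applies.
  by_cases hvJ : v ∈ J
  · obtain ⟨h1, h2⟩ := h J (hJ.trans hA) hne
    have hsum' : ∑ u ∈ J, d' u ≤ ∑ u ∈ J, d u - 2 * β := by
      rw [← Finset.add_sum_erase J d' hvJ, ← Finset.add_sum_erase J d hvJ]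
      have : ∑ u ∈ J.erase v, d' u ≤ ∑ u ∈ J.erase v, d u := Finset.sum_le_sum fun u _ => hd u
      linarith
    push_cast at h1 h2
    refine ⟨by linarith, fun hJm => ?_⟩
    have := h2 hJm
    linarith
  · have hJv : insert v J ⊆ A := Finset.insert_subset hvA (hJ.trans hA)
    obtain ⟨h1, h2⟩ := h (insert v J) hJv (Finset.insert_nonempty v J)
    rw [Finset.card_insert_of_notMem hvJ, Finset.sum_insert hvJ] at h1 h2
    have hjn : J.card < Fintype.card V := by
      have := Finset.card_le_univ (insert v J)
      rw [Finset.card_insert_of_notMem hvJ] at this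
      omega
    have hj1 : 1 ≤ J.card := hne.card_pos
    have havg : ∑ u ∈ J, d u ≤ J.card * d v := by
      rw [← nsmul_eq_mul]
      exact Finset.sum_le_card_nsmul _ _ _ fun u hu => hmax u (hA (hJ hu))
    push_cast at h1 h2
    have hGj := hG _ hj1 hjn
    have hRj := hR _ hj1
    have hee := he J v hvJ
    have he0J := he0 J
    generalize hj : J.card = j at *
    have hjpos : (0 : ℝ) < j + 1 := by positivity
    have hj0 : (0 : ℝ) ≤ j := by positivity
    have hcrude : ∑ u ∈ J, d' u ≤ j * G j + 2 * β * r := by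
      have hG' : (j + 1) * G (j + 1) + 2 * β ≤ (j + 1) * G j := by
        have := mul_le_mul_of_nonneg_left hGj hjpos.le
        rw [mul_add, mul_div_cancel₀ _ hjpos.ne'] at this
        exact this
      have h3 : (j + 1) * ∑ u ∈ J, d u ≤ (j + 1) * (j * G j + 2 * β * r) := by
        have h4 := mul_le_mul_of_nonneg_left h1 hj0
        have h5 := mul_le_mul_of_nonneg_left hG' hj0
        have h6 : 0 ≤ β * r := by positivity
        linarith
      exact hsum.trans (le_of_mul_le_mul_left h3 hjpos)
    refine ⟨hcrude, fun hjm => ?_⟩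
    -- Below `m` the larger set is still small, and the summand `1` in `hR` absorbs the `j` inside
    -- edges gained. At `m` it is not, and `hm` converts the undiscounted bound.
    rcases hjm.lt_or_eq with hlt | rfl
    · have hR' : (j + 1) * R (j + 1) + β + (j + 1) ≤ (j + 1) * R j := by
        have := mul_le_mul_of_nonneg_left (hRj hlt) hjpos.le
        rw [mul_add, mul_add, mul_div_cancel₀ _ hjpos.ne', mul_one] at this
        exact this
      have h3 : (j + 1) * (∑ u ∈ J, d u - e J) ≤ (j + 1) * (j * R j + β * r) := by
        have h4 := mul_le_mul_of_nonneg_left (h2 (by omega)) hj0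
        have h5 := mul_le_mul_of_nonneg_left hR' hj0
        have h6 : 0 ≤ β * r := by positivity
        have h7 := mul_le_mul_of_nonneg_left hee hj0
        linarith
      have := le_of_mul_le_mul_left h3 hjpos
      linarith
    · linarith

end Danger

/-! ### Maker's strategy: ease the most dangerous vertex -/

section MakerStrategy

variable {n : ℕ}

/-- The vertices whose degree in `M` is smaller than `k`. -/
def deficient (k : ℕ) (M : Finset (Sym2 (Fin n))) : Finset (Fin n) :=
  Finset.univ.filter (degreeIn M · < k)

/-- The danger of a vertex in a position of the minimum degree game. -/
noncomputable def danger (β : ℝ) (M B : Finset (Sym2 (Fin n))) (v : Fin n) : ℝ :=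
  degreeIn B v - 2 * β * degreeIn M v

theorem inv_succ_le_log_sub_log {j : ℕ} (hj : 1 ≤ j) :
    1 / ((j : ℝ) + 1) ≤ Real.log ((j + 1 : ℕ) : ℝ) - Real.log j := by
  have hj0 : (0 : ℝ) < j := by exact_mod_cast hj
  push_cast
  rw [← Real.log_div (by positivity) (by positivity)]
  refine le_trans (le_of_eq ?_) (Real.one_sub_inv_le_log_of_pos (by positivity))
  field_simp
  ring

/-- The left side of `hineq` bounds the degree a deficient vertex can have in both colours: `2βk`
undoes the subtraction in its danger, the lone `b` is the allowance `βr` within a round, `k` covers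
Maker's own edges, and the rest dominates `R 1`. -/
theorem makerWins_minDegree [NeZero n] {k a b m : ℕ} (ha : 1 ≤ a) (hm : 1 ≤ m)
    (hmn : m ≤ n) {β : ℝ} (hβ : β = b / a)
    (hineq : 2 * β * k + 2 * β * (Real.log n - Real.log m) + b / m + m + β * Real.log m + b + k
      < n) : MakerWins (completeEdges n) (minDegreeSets n k) a b := by
  have ha0 : (0 : ℝ) < a := by exact_mod_cast ha
  have hm0 : (0 : ℝ) < m := by exact_mod_cast hm
  have hβ0 : 0 ≤ β := by rw [hβ]; positivity
  have hβa : β * a = b := by rw [hβ]; field_simp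
  set G : ℕ → ℝ := fun j => 2 * β * (Real.log n - Real.log j) with hGdef
  -- At `j = m` this is `G m + b / m`, where `b / m` spreads the allowance `βr ≤ b` over `m`
  -- vertices. Going down from `m`, each step pays `1` for the discount and a harmonic term with
  -- factor `β` instead of `2β`.
  set R : ℕ → ℝ := fun j => 2 * β * (Real.log n - Real.log m) + b / m + (m - j) +
    β * (Real.log m - Real.log j) with hRdef
  have hG : ∀ j : ℕ, 1 ≤ j → j < Fintype.card (Fin n) → G (j + 1) + 2 * β / (j + 1) ≤ G j := by
    intro j hj _
    have := mul_le_mul_of_nonneg_left (inv_succ_le_log_sub_log hj)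
      (mul_nonneg zero_le_two hβ0)
    rw [mul_one_div] at this
    simp only [hGdef]
    linarith
  have hR : ∀ j : ℕ, 1 ≤ j → j < m → R (j + 1) + β / (j + 1) + 1 ≤ R j := by
    intro j hj _
    have := mul_le_mul_of_nonneg_left (inv_succ_le_log_sub_log hj) hβ0
    rw [mul_one_div] at this
    simp only [hRdef]
    push_cast at this ⊢
    linarith
  have hGR : ∀ r : ℕ, r ≤ a → m * G m + β * r ≤ m * R m := by
    intro r hr
    have h1 : β * r ≤ b := by
      rw [← hβa]
      exact mul_le_mul_of_nonneg_left (by exact_mod_cast hr) hβ0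
    have h2 : (m : ℝ) * (b / m) = b := by field_simp
    simp only [hGdef, hRdef]
    rw [sub_self, sub_self, mul_zero, add_zero, add_zero, mul_add, h2]
    linarith
  have hfree : ∀ (r : ℕ) (M B : Finset (Sym2 (Fin n))), r ≤ a → B ⊆ completeEdges n →
      DangerBound β G R m (fun J => (insideCount B J : ℝ)) r (deficient k M) (danger β M B) →
      ∀ v ∈ deficient k M, ∃ e ∈ completeEdges n \ (M ∪ B), v ∈ e := by
    intro r M B hr hB hD v hv
    have hvk : degreeIn M v < k := (Finset.mem_filter.1 hv).2
    apply exists_free_edge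
    -- A single vertex has no inside edges, so here the discounted bound controls the danger itself.
    have h1 := (hD {v} (by simpa using hv) (by simp)).2 (by simpa using hm)
    have hin : insideCount B {v} = 0 := by
      unfold insideCount
      rw [Finset.card_eq_zero, Finset.filter_eq_empty_iff]
      intro e he hev
      have := not_isDiag_of_mem_completeEdges (hB he)
      simp at hev
      exact this (by rw [hev]; rfl)
    have h2 : β * r ≤ b := by
      rw [← hβa]
      exact mul_le_mul_of_nonneg_left (by exact_mod_cast hr) hβ0
    have hk' : (degreeIn M v : ℝ) + 1 ≤ k := by exact_mod_cast hvk
    have h3 : 2 * β * (degreeIn M v) ≤ 2 * β * k :=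
      mul_le_mul_of_nonneg_left (by linarith) (by positivity)
    simp only [Finset.sum_singleton, hin, Finset.card_singleton, hRdef, danger, Nat.cast_one,
      Nat.cast_zero, Real.log_one, sub_zero, one_mul] at h1
    have h4 : ((degreeIn M v + degreeIn B v + 1 : ℕ) : ℝ) < n := by
      push_cast
      linarith
    have h5 : degreeIn M v + degreeIn B v + 1 < n := by exact_mod_cast h4
    omega
  have hturn : ∀ (r : ℕ) (M B : Finset (Sym2 (Fin n))), r ≤ a → B ⊆ completeEdges n →
      DangerBound β G R m (fun J => (insideCount B J : ℝ)) r (deficient k M) (danger β M B) →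
      ∃ T, IsLegalMove r (completeEdges n \ (M ∪ B)) T ∧
        DangerBound β G R m (fun J => (insideCount B J : ℝ)) 0 (deficient k (T ∪ M))
          (danger β (T ∪ M) B) := by
    intro r
    induction r with
    | zero =>
      intro M B _ _ hD
      exact ⟨∅, ⟨by simp, by simp⟩, by simpa using hD⟩
    | succ r ih =>
      intro M B hr hB hD
      -- On an exhausted board `hfree` leaves no deficient vertex, and the bound is vacuous.
      rcases (completeEdges n \ (M ∪ B)).eq_empty_or_nonempty with hF | ⟨e₀, he₀⟩
      · refine ⟨∅, ⟨by simp, by simp [hF]⟩, ?_⟩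
        intro J hJ hne
        obtain ⟨v, hv⟩ := hne
        obtain ⟨e, he, -⟩ := hfree _ M B hr hB hD v (by simpa using hJ hv)
        simp [hF] at he
      · have hmove : ∃ e ∈ completeEdges n \ (M ∪ B),
            DangerBound β G R m (fun J => (insideCount B J : ℝ)) r (deficient k (insert e M))
              (danger β (insert e M) B) := by
          have hsub : ∀ e, deficient k (insert e M) ⊆ deficient k M := by
            intro e v hv
            refine Finset.mem_filter.2 ⟨Finset.mem_univ _, ?_⟩
            exact (degreeIn_mono (Finset.subset_insert e M) v).trans_lt (Finset.mem_filter.1 hv).2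
          rcases (deficient k M).eq_empty_or_nonempty with hA | hA
          · refine ⟨e₀, he₀, fun J hJ hne => ?_⟩
            obtain ⟨v, hv⟩ := hne
            have := hsub e₀ (hJ hv)
            simp [hA] at this
          · obtain ⟨v, hvA, hmax⟩ := Finset.exists_max_image _ (danger β M B) hA
            obtain ⟨e, he, hve⟩ := hfree _ M B hr hB hD v hvA
            have heM : e ∉ M := fun h => (Finset.mem_sdiff.1 he).2 (Finset.mem_union_left _ h)
            refine ⟨e, he, hD.ease hβ0 hG hR (hGR r (by omega)) (fun J => Nat.cast_nonneg _) ?_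
              (hsub e) ?_ hvA hmax ?_⟩
            · intro J u _
              exact_mod_cast insideCount_insert_le
                (fun e he => not_isDiag_of_mem_completeEdges (hB he)) J u
            · intro u
              have : (degreeIn M u : ℝ) ≤ degreeIn (insert e M) u := by
                exact_mod_cast degreeIn_mono (Finset.subset_insert e M) u
              have := mul_le_mul_of_nonneg_left this (mul_nonneg zero_le_two hβ0)
              simp only [danger]
              linarith
            · simp only [danger, degreeIn_insert_of_mem heM hve]
              push_cast
              linarith
        obtain ⟨e, he, hD'⟩ := hmove
        obtain ⟨T, ⟨hTF, hTc⟩, hT⟩ := ih (insert e M) B (by omega) hB hD'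
        have heT : e ∉ T := fun h => by
          have := hTF h
          simp at this
        refine ⟨insert e T, ⟨?_, ?_⟩, ?_⟩
        · refine Finset.insert_subset he (hTF.trans ?_)
          exact Finset.sdiff_subset_sdiff (Finset.Subset.refl _)
            (Finset.union_subset_union_left (Finset.subset_insert e M))
        · rw [Finset.card_insert_of_notMem heT, hTc, Finset.insert_union,
            Finset.sdiff_insert, Finset.card_erase_of_mem he]
          have := Finset.card_pos.2 ⟨e, he⟩
          omega
        · rwa [Finset.insert_union, ← Finset.union_insert]
  refine makerWins_of_invariant ha
    (fun M B => B ⊆ completeEdges n ∧ DangerBound β G R m (fun J => (insideCount B J : ℝ)) 0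
      (deficient k M) (danger β M B)) ⟨Finset.empty_subset _, ?_⟩ ?_ ?_
  · intro J _ hne
    have hJn : J.card ≤ n := by simpa using Finset.card_le_univ J
    have hJ1 : (0 : ℝ) < J.card := by exact_mod_cast hne.card_pos
    have hlog : Real.log J.card ≤ Real.log n := Real.log_le_log hJ1 (by exact_mod_cast hJn)
    have hsum : ∑ v ∈ J, danger β ∅ ∅ v = 0 := by simp [danger, degreeIn]
    have hG0 : 0 ≤ G J.card := mul_nonneg (by positivity) (by linarith)
    rw [hsum]
    refine ⟨by simp only [Nat.cast_zero, mul_zero, add_zero]; positivity, fun hJm => ?_⟩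
    have hJm' : (J.card : ℝ) ≤ m := by exact_mod_cast hJm
    have hlog' : Real.log J.card ≤ Real.log m := Real.log_le_log hJ1 hJm'
    have hR0 : 0 ≤ R J.card := by
      have h1 : 0 ≤ β * (Real.log m - Real.log J.card) := mul_nonneg hβ0 (by linarith)
      have h2 : 0 ≤ 2 * β * (Real.log n - Real.log m) :=
        mul_nonneg (by positivity) (sub_nonneg.2 (Real.log_le_log hm0 (by exact_mod_cast hmn)))
      have h3 : (0 : ℝ) ≤ b / m := by positivity
      simp only [hRdef]
      linarith
    simp only [insideCount, Finset.filter_empty, Finset.card_empty, Nat.cast_zero, mul_zero,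
      add_zero, sub_zero]
    positivity
  · rintro M B S hM ⟨hB, hD⟩ hS
    have hSX : S ⊆ completeEdges n := hS.1.trans Finset.sdiff_subset
    have hSB : S ∪ B ⊆ completeEdges n := Finset.union_subset hSX hB
    have hdis : Disjoint S B := by
      refine Finset.disjoint_left.2 fun e he heB => ?_
      exact (Finset.mem_sdiff.1 (hS.1 he)).2 (Finset.mem_union_right _ heB)
    have hSb : (S.card : ℝ) ≤ b := by exact_mod_cast hS.2.trans_le (min_le_left _ _)
    have hD' : DangerBound β G R m (fun J => (insideCount (S ∪ B) J : ℝ)) a (deficient k M)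
        (danger β M (S ∪ B)) := by
      intro J hJ hne
      obtain ⟨h1, h2⟩ := hD J hJ hne
      -- The increase is at most `2b = 2βa`. After discounting the new inside edges it is at most `b
      -- = βa`. These are the allowances for `r = a`.
      have hsum : ∑ v ∈ J, danger β M (S ∪ B) v ≤
          ∑ v ∈ J, danger β M B v + (S.card + insideCount S J) := by
        have h3 : ((∑ v ∈ J, degreeIn S v : ℕ) : ℝ) ≤ ((S.card + insideCount S J : ℕ) : ℝ) := by
          exact_mod_cast sum_degreeIn_le S J
        push_cast at h3
        refine le_trans ?_ (add_le_add_right h3 _)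
        rw [← Finset.sum_add_distrib]
        refine Finset.sum_le_sum fun v _ => ?_
        have : (degreeIn (S ∪ B) v : ℝ) ≤ degreeIn S v + degreeIn B v := by
          exact_mod_cast degreeIn_union_le S B v
        simp only [danger]
        linarith
      have hin : (insideCount S J : ℝ) ≤ S.card := by exact_mod_cast insideCount_le_card S J
      have hunion : (insideCount (S ∪ B) J : ℝ) = insideCount S J + insideCount B J := by
        exact_mod_cast insideCount_union hdis J
      simp only [Nat.cast_zero, mul_zero, add_zero] at h1 h2
      refine ⟨by linarith, fun hJm => ?_⟩
      have := h2 hJm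
      simp only [hunion]
      linarith
    obtain ⟨T, hT, hTD⟩ := hturn a M (S ∪ B) le_rfl hSB hD'
    refine ⟨T, ?_, hSB, hTD⟩
    have hset : (completeEdges n \ (M ∪ B)) \ S = completeEdges n \ (M ∪ (S ∪ B)) := by
      ext e
      simp only [Finset.mem_sdiff, Finset.mem_union]
      tauto
    rwa [hset]
  · rintro M B hM ⟨hB, hD⟩ hX
    refine ⟨M, (mem_minDegreeSets hM).2 fun v => ?_, Finset.Subset.refl _⟩
    by_contra hlt
    obtain ⟨e, he, -⟩ := hfree 0 M B (Nat.zero_le _) hB hD v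
      (Finset.mem_filter.2 ⟨Finset.mem_univ _, by omega⟩)
    rw [Finset.sdiff_eq_empty_iff_subset.2 hX] at he
    simp at he

end MakerStrategy

/-! ### Breaker's strategy: isolate a vertex of a clique -/

section BreakerStrategy

variable {n k a b : ℕ}

/-- Breaker holds the game once he has claimed all edges at some vertex. -/
theorem breakerHolds_of_isolated [NeZero n] (hk : 1 ≤ k) {v : Fin n}
    {M B : Finset (Sym2 (Fin n))} (hM : ∀ e ∈ M, v ∉ e)
    (hB : ∀ e ∈ completeEdges n, v ∈ e → e ∈ B) :
    BreakerHolds (completeEdges n) (minDegreeSets n k) a b M B := by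
  intro t
  induction t generalizing M B with
  | zero =>
    rintro ⟨W, hW, hWM⟩
    have h := (mem_minDegreeSets hW.1).1 hW v
    have h0 : degreeIn W v = 0 := by
      unfold degreeIn
      rw [Finset.card_eq_zero, Finset.filter_eq_empty_iff]
      exact fun e he => hM e (hWM he)
    omega
  | succ t ih =>
    intro hw
    obtain ⟨S, hS⟩ := exists_isLegalMove b (completeEdges n \ (M ∪ B))
    obtain ⟨T, hT, hTw⟩ := hw S hS
    refine ih ?_ (fun e he hve => Finset.mem_union_right _ (hB e he hve)) hTw
    intro e he hve
    rcases Finset.mem_union.1 he with h | h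
    · have := hT.1 h
      simp only [Finset.mem_sdiff, Finset.mem_union, not_or] at this
      exact this.1.2.2 (hB e this.1.1 hve)
    · exact hM e h hve

/-- Breaker holds the game if he can claim all missing edges at an isolated vertex at once. -/
theorem breakerHolds_of_degreeIn_le [NeZero n] (hk : 1 ≤ k) {v : Fin n}
    {M B : Finset (Sym2 (Fin n))} (hM : ∀ e ∈ M, v ∉ e)
    (hB : degreeIn (completeEdges n \ B) v ≤ b) :
    BreakerHolds (completeEdges n) (minDegreeSets n k) a b M B := by
  have hD : (completeEdges n \ B).filter (v ∈ ·) ⊆ completeEdges n \ (M ∪ B) := by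
    intro e he
    simp only [Finset.mem_filter, Finset.mem_sdiff, Finset.mem_union, not_or] at he ⊢
    exact ⟨he.1.1, fun h => hM e h he.2, he.1.2⟩
  obtain ⟨S, hDS, hS⟩ := exists_isLegalMove_superset hD hB
  refine BreakerHolds.of_move hS fun T hT => breakerHolds_of_isolated hk (v := v) ?_ ?_
  · intro e he hve
    rcases Finset.mem_union.1 he with h | h
    · have := hT.1 h
      simp only [Finset.mem_sdiff, Finset.mem_union, not_or] at this
      exact this.2 (hDS (Finset.mem_filter.2 ⟨Finset.mem_sdiff.2 ⟨this.1.1, this.1.2.2⟩, hve⟩))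
    · exact hM e h hve
  · intro e he hve
    by_cases heB : e ∈ B
    · exact Finset.mem_union_right _ heB
    · exact Finset.mem_union_left _ (hDS (Finset.mem_filter.2 ⟨Finset.mem_sdiff.2 ⟨he, heB⟩, hve⟩))

/-- No edge of Maker meets `C`, and all edges inside `C` belong to Breaker. -/
structure IsIsolatedClique (M B : Finset (Sym2 (Fin n))) (C : Finset (Fin n)) : Prop where
  isolated : ∀ v ∈ C, ∀ e ∈ M, v ∉ e
  clique : ∀ u ∈ C, ∀ v ∈ C, u ≠ v → s(u, v) ∈ B

theorem IsIsolatedClique.mono {M B B' : Finset (Sym2 (Fin n))} {C C' : Finset (Fin n)}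
    (h : IsIsolatedClique M B C) (hB : B ⊆ B') (hC : C' ⊆ C) : IsIsolatedClique M B' C' :=
  ⟨fun v hv => h.isolated v (hC hv), fun u hu v hv huv => hB (h.clique u (hC hu) v (hC hv) huv)⟩

/-- Each edge claimed by Maker hits at most one vertex of a clique of Breaker. -/
theorem IsIsolatedClique.exists_subset {M B T : Finset (Sym2 (Fin n))} {C : Finset (Fin n)}
    {c : ℕ} (h : IsIsolatedClique M B C) (hT : Disjoint T B) (hc : c + T.card ≤ C.card) :
    ∃ C' ⊆ C, C'.card = c ∧ IsIsolatedClique (T ∪ M) B C' := by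
  set K := C.filter (fun v => ∃ e ∈ T, v ∈ e) with hK
  have hKT : K.card ≤ T.card := by
    -- Each spoiled vertex is sent to an edge of `T` at it. This is injective: an edge with two ends
    -- in `C` belongs to Breaker. The loop is a dummy value outside `K`.
    have hex : ∀ v, ∃ e, v ∈ K → e ∈ T ∧ v ∈ e := by
      intro v
      by_cases hv : v ∈ K
      · obtain ⟨-, e, he⟩ := Finset.mem_filter.1 hv
        exact ⟨e, fun _ => he⟩
      · exact ⟨s(v, v), fun h => absurd h hv⟩
    choose f hf using hex
    refine Finset.card_le_card_of_injOn f (fun v hv => (hf v hv).1) ?_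
    intro u hu v hv huv
    by_contra hne
    have h1 := (hf u hu).2
    have h2 := (hf v hv).2
    rw [← huv] at h2
    have h3 : f u = s(u, v) := (Sym2.mem_and_mem_iff hne).1 ⟨h1, h2⟩
    have h4 := h.clique u (Finset.mem_filter.1 hu).1 v (Finset.mem_filter.1 hv).1 hne
    rw [← h3] at h4
    exact Finset.disjoint_left.1 hT (hf u hu).1 h4
  have hcard : c ≤ (C \ K).card := by
    rw [Finset.card_sdiff_of_subset (show K ⊆ C from Finset.filter_subset _ _)]
    omega
  obtain ⟨C', hC', hC'c⟩ := Finset.exists_subset_card_eq hcard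
  refine ⟨C', hC'.trans Finset.sdiff_subset, hC'c, fun v hv e he hve => ?_, ?_⟩
  · have hv' := Finset.mem_sdiff.1 (hC' hv)
    rcases Finset.mem_union.1 he with hT' | hM'
    · exact hv'.2 (Finset.mem_filter.2 ⟨hv'.1, e, hT', hve⟩)
    · exact h.isolated v hv'.1 e hM' hve
  · exact (h.mono (Finset.Subset.refl _) (hC'.trans Finset.sdiff_subset)).clique

theorem disjoint_of_isLegalMove {M B S T : Finset (Sym2 (Fin n))}
    (hT : IsLegalMove a ((completeEdges n \ (M ∪ B)) \ S) T) : Disjoint T (S ∪ B) := by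
  refine Finset.disjoint_left.2 fun e he heSB => ?_
  have := hT.1 he
  simp only [Finset.mem_sdiff, Finset.mem_union, not_or] at this heSB
  tauto

/-- Breaker can enlarge an isolated clique by one vertex in a round. -/
theorem breakerHolds_of_extend_clique {M B : Finset (Sym2 (Fin n))} {C : Finset (Fin n)} {t : ℕ}
    (hC : IsIsolatedClique M B C) (hCt : C.card = t) (hMt : M.card ≤ a * t)
    (hb : (a + 1) * (t + a + 1) ≤ b) (hn : t + 2 * (a * t) + (a + 1) ≤ n)
    (h : ∀ (M' B' : Finset (Sym2 (Fin n))) (C' : Finset (Fin n)), IsIsolatedClique M' B' C' →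
      C'.card = t + 1 → M'.card ≤ a * (t + 1) →
      BreakerHolds (completeEdges n) (minDegreeSets n k) a b M' B') :
    BreakerHolds (completeEdges n) (minDegreeSets n k) a b M B := by
  set Z : Finset (Fin n) := M.biUnion (fun e => Finset.univ.filter (· ∈ e)) with hZ
  have hZc : Z.card ≤ 2 * (a * t) := by
    refine (Finset.card_biUnion_le_card_mul _ _ 2 fun e _ => ?_).trans (by omega)
    refine (card_filter_mem_le Finset.univ e).trans ?_
    split_ifs <;> simp
  have hout : a + 1 ≤ (Finset.univ \ (C ∪ Z)).card := by
    rw [Finset.card_sdiff_of_subset (Finset.subset_univ _), Finset.card_univ, Fintype.card_fin]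
    have := Finset.card_union_le C Z
    omega
  -- Adding `a + 1` fresh vertices leaves a net gain of one after Maker's `a` edges.
  obtain ⟨U, hU, hUc⟩ := Finset.exists_subset_card_eq hout
  have hUC : Disjoint C U := by
    refine Finset.disjoint_right.2 fun v hv hvC => ?_
    exact (Finset.mem_sdiff.1 (hU hv)).2 (Finset.mem_union_left _ hvC)
  have hUiso : ∀ v ∈ U, ∀ e ∈ M, v ∉ e := by
    intro v hv e he hve
    refine (Finset.mem_sdiff.1 (hU hv)).2 (Finset.mem_union_right _ ?_)
    exact Finset.mem_biUnion.2 ⟨e, he, by simpa using hve⟩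
  set D := (U ×ˢ (C ∪ U)).image (fun p => s(p.1, p.2)) ∩ (completeEdges n \ (M ∪ B)) with hD
  have hDc : D.card ≤ b := by
    refine (Finset.card_le_card Finset.inter_subset_left).trans (Finset.card_image_le.trans ?_)
    rw [Finset.card_product, Finset.card_union_of_disjoint hUC, hUc, hCt, ← add_assoc]
    exact hb
  obtain ⟨S, hDS, hS⟩ := exists_isLegalMove_superset Finset.inter_subset_right hDc
  refine BreakerHolds.of_move hS fun T hT => ?_
  have hmem : ∀ u ∈ U, ∀ v ∈ C ∪ U, u ≠ v → s(u, v) ∈ S ∪ B := by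
    intro u hu v hv huv
    by_cases hB : s(u, v) ∈ B
    · exact Finset.mem_union_right _ hB
    · refine Finset.mem_union_left _ (hDS (Finset.mem_inter.2 ⟨?_, ?_⟩))
      · exact Finset.mem_image.2 ⟨(u, v), Finset.mem_product.2 ⟨hu, hv⟩, rfl⟩
      · simp only [Finset.mem_sdiff, Finset.mem_union, not_or]
        exact ⟨mk_mem_completeEdges.2 huv,
          fun h => hUiso u hu _ h (Sym2.mem_mk_left u v), hB⟩
  have hclique : IsIsolatedClique M (S ∪ B) (C ∪ U) := by
    refine ⟨fun v hv => ?_, fun u hu v hv huv => ?_⟩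
    · rcases Finset.mem_union.1 hv with h | h
      · exact hC.isolated v h
      · exact hUiso v h
    · rcases Finset.mem_union.1 hu with h | h
      · rcases Finset.mem_union.1 hv with h' | h'
        · exact Finset.mem_union_right _ (hC.clique u h v h' huv)
        · rw [Sym2.eq_swap]
          exact hmem v h' u hu huv.symm
      · exact hmem u h v hv huv
  have hTa : T.card ≤ a := hT.2.trans_le (min_le_left _ _)
  obtain ⟨C', -, hC'c, hC'⟩ := hclique.exists_subset (disjoint_of_isLegalMove hT) (c := t + 1)
    (by rw [Finset.card_union_of_disjoint hUC]; omega)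
  refine h _ _ C' hC' hC'c ((Finset.card_union_le _ _).trans ?_)
  rw [mul_add, mul_one]
  omega

/-- Breaker can raise his degree at all but `a` vertices of an isolated clique. -/
theorem breakerHolds_of_raise_degree {M B : Finset (Sym2 (Fin n))} {C : Finset (Fin n)}
    {r s q : ℕ} (hC : IsIsolatedClique M B C) (hCr : C.card = r + a) (hq : (r + a) * q ≤ b)
    (hs : ∀ v ∈ C, degreeIn (completeEdges n \ B) v ≤ s)
    (h : ∀ (M' B' : Finset (Sym2 (Fin n))) (C' : Finset (Fin n)), IsIsolatedClique M' B' C' →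
      C'.card = r → (∀ v ∈ C', degreeIn (completeEdges n \ B') v ≤ s - q) →
      BreakerHolds (completeEdges n) (minDegreeSets n k) a b M' B') :
    BreakerHolds (completeEdges n) (minDegreeSets n k) a b M B := by
  have hex : ∀ v : Fin n, ∃ D ⊆ (completeEdges n \ B).filter (v ∈ ·),
      D.card = min q (degreeIn (completeEdges n \ B) v) := fun v =>
    Finset.exists_subset_card_eq (min_le_right _ _)
  choose D hD hDc using hex
  have hDF : C.biUnion D ⊆ completeEdges n \ (M ∪ B) := by
    intro e he
    obtain ⟨v, hv, hev⟩ := Finset.mem_biUnion.1 he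
    have := hD v hev
    simp only [Finset.mem_filter, Finset.mem_sdiff, Finset.mem_union, not_or] at this ⊢
    exact ⟨this.1.1, fun hM => hC.isolated v hv e hM this.2, this.1.2⟩
  have hDb : (C.biUnion D).card ≤ b := by
    refine (Finset.card_biUnion_le_card_mul _ _ q fun v _ => ?_).trans (by rwa [hCr])
    rw [hDc]
    exact min_le_left _ _
  obtain ⟨S, hDS, hS⟩ := exists_isLegalMove_superset hDF hDb
  refine BreakerHolds.of_move hS fun T hT => ?_
  have hTa : T.card ≤ a := hT.2.trans_le (min_le_left _ _)
  obtain ⟨C', hC'C, hC'c, hC'⟩ := (hC.mono (Finset.subset_union_right (s₁ := S))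
    (Finset.Subset.refl C)).exists_subset (disjoint_of_isLegalMove hT) (c := r) (by omega)
  refine h _ _ C' hC' hC'c fun v hv => ?_
  have hsub : (completeEdges n \ (S ∪ B)).filter (v ∈ ·) ⊆
      (completeEdges n \ B).filter (v ∈ ·) \ D v := by
    intro e he
    simp only [Finset.mem_filter, Finset.mem_sdiff, Finset.mem_union, not_or] at he ⊢
    refine ⟨⟨⟨he.1.1, he.1.2.2⟩, he.2⟩, fun heD => he.1.2.1 (hDS ?_)⟩
    exact Finset.mem_biUnion.2 ⟨v, hC'C hv, heD⟩
  have h1 := Finset.card_le_card hsub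
  rw [Finset.card_sdiff_of_subset (hD v), hDc] at h1
  have h2 := hs v (hC'C hv)
  unfold degreeIn at *
  omega

/-- The second stage of Breaker's strategy: starting from an isolated clique of `a * q` vertices,
he isolates one of them. -/
theorem breakerHolds_of_isIsolatedClique [NeZero n] (hk : 1 ≤ k) (ha : 1 ≤ a) {q : ℕ}
    (hq : 1 ≤ q) : ∀ {s : ℕ} {M B : Finset (Sym2 (Fin n))} {C : Finset (Fin n)},
    (s : ℝ) ≤ b + b / a * (Real.log ((q + 1 : ℕ) : ℝ) - Real.log 2) - (q - 1) →
    IsIsolatedClique M B C → C.card = a * q →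
    (∀ v ∈ C, degreeIn (completeEdges n \ B) v ≤ s) →
    BreakerHolds (completeEdges n) (minDegreeSets n k) a b M B := by
  induction q, hq using Nat.le_induction with
  | base =>
    intro s M B C hs hC hCc hdeg
    norm_num at hs
    obtain ⟨v, hv⟩ : C.Nonempty := by rw [← Finset.card_pos]; omega
    exact breakerHolds_of_degreeIn_le hk (hC.isolated v hv) ((hdeg v hv).trans hs)
  | succ q hq ih =>
    intro s M B C hs hC hCc hdeg
    -- If `s ≤ b`, one move isolates a vertex. Otherwise `s > b` keeps the natural subtraction below
    -- from truncating.
    rcases le_or_gt s b with hsb | hsb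
    · obtain ⟨v, hv⟩ : C.Nonempty := by rw [← Finset.card_pos, hCc]; positivity
      exact breakerHolds_of_degreeIn_le hk (hC.isolated v hv) ((hdeg v hv).trans hsb)
    · refine breakerHolds_of_raise_degree (r := a * q) (q := b / (a * (q + 1))) hC
        (by rw [hCc]; ring) ?_ hdeg ?_
      · have : a * q + a = a * (q + 1) := by ring
        rw [this]
        exact Nat.mul_div_le _ _
      · intro M' B' C' hC' hC'c hdeg'
        refine ih ?_ hC' hC'c hdeg'
        have hle : b / (a * (q + 1)) ≤ s := (Nat.div_le_self _ _).trans hsb.le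
        have ha0 : (0 : ℝ) < a := by exact_mod_cast ha
        -- Rounding down costs less than `1` per round, whence the term `q - 1` in the hypothesis on
        -- `s`.
        have hfloor : (b : ℝ) / (a * (q + 1)) ≤ (b / (a * (q + 1)) : ℕ) + 1 := by
          have h1 : b < a * (q + 1) * (b / (a * (q + 1)) + 1) :=
            Nat.lt_mul_div_succ b (by positivity)
          rw [div_le_iff₀ (by positivity), mul_comm]
          exact_mod_cast h1.le
        have hlog : Real.log ((q + 1 + 1 : ℕ) : ℝ) - Real.log ((q + 1 : ℕ) : ℝ) ≤
            1 / ((q : ℝ) + 1) := by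
          rw [← Real.log_div (by positivity) (by positivity)]
          refine (Real.log_le_sub_one_of_pos (by positivity)).trans (le_of_eq ?_)
          push_cast
          field_simp
          ring
        have hmul := mul_le_mul_of_nonneg_left hlog (by positivity : (0 : ℝ) ≤ b / a)
        have heq : (b : ℝ) / a * (1 / ((q : ℝ) + 1)) = b / (a * (q + 1)) := by
          field_simp
        rw [heq] at hmul
        rw [Nat.cast_sub hle]
        push_cast at hs hmul hfloor ⊢
        linarith

theorem breakerWins_minDegree [NeZero n] (hk : 1 ≤ k) (ha : 1 ≤ a) {q : ℕ} (hq : 1 ≤ q)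
    (hclique : (a + 1) * (a * q + a + 1) ≤ b) (hn : a * q + 2 * (a * (a * q)) + (a + 1) ≤ n)
    (hlog : (n : ℝ) ≤ b + b / a * (Real.log ((q + 1 : ℕ) : ℝ) - Real.log 2) - (q - 1)) :
    BreakerWins (completeEdges n) (minDegreeSets n k) a b := by
  -- Here `j` counts the vertices the clique still lacks. Since each earlier round added one vertex,
  -- Maker owns at most `a` edges per clique vertex.
  have key : ∀ j ≤ a * q, ∀ (M B : Finset (Sym2 (Fin n))) (C : Finset (Fin n)),
      IsIsolatedClique M B C → C.card = a * q - j → M.card ≤ a * (a * q - j) →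
      BreakerHolds (completeEdges n) (minDegreeSets n k) a b M B := by
    intro j
    induction j with
    | zero =>
      intro _ M B C hC hCc _
      refine breakerHolds_of_isIsolatedClique hk ha hq hlog hC hCc fun v _ => ?_
      exact (degreeIn_mono Finset.sdiff_subset v).trans
        ((degreeIn_completeEdges v).trans_le (Nat.sub_le _ _))
    | succ j ih =>
      intro hj M B C hC hCc hMc
      have hle : a * q - (j + 1) ≤ a * q := Nat.sub_le _ _
      refine breakerHolds_of_extend_clique hC hCc hMc ?_ ?_ ?_
      · exact (Nat.mul_le_mul_left _ (by omega)).trans hclique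
      · have := Nat.mul_le_mul_left a hle
        omega
      · intro M' B' C' hC' hC'c hM'c
        have hsucc : a * q - (j + 1) + 1 = a * q - j := by omega
        rw [hsucc] at hC'c hM'c
        exact ih (by omega) M' B' C' hC' hC'c hM'c
  exact breakerWins_of_breakerHolds (key (a * q) le_rfl ∅ ∅ ∅ ⟨by simp, by simp⟩ (by simp)
    (by simp))

theorem breakerWins_minDegree_of_le [NeZero n] (hk : 1 ≤ k) (hb : n ≤ b) :
    BreakerWins (completeEdges n) (minDegreeSets n k) a b := by
  refine breakerWins_of_breakerHolds (breakerHolds_of_degreeIn_le hk (v := 0) (by simp) ?_)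
  exact (degreeIn_mono Finset.sdiff_subset _).trans ((degreeIn_completeEdges _).trans_le (by omega))

end BreakerStrategy

/-! ### Asymptotic estimates -/

section Asymptotic

theorem tendsto_log_natCast : Tendsto (fun n : ℕ => Real.log n) atTop atTop :=
  Real.tendsto_log_atTop.comp tendsto_natCast_atTop_atTop

theorem isLittleO_log_natCast_pow (p : ℕ) :
    (fun n : ℕ => Real.log n ^ p) =o[atTop] (fun n : ℕ => (n : ℝ)) :=
  (Real.isLittleO_pow_log_id_atTop (n := p)).comp_tendsto tendsto_natCast_atTop_atTop

theorem eventually_log_pow_le (p : ℕ) {c : ℝ} (hc : 0 < c) :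
    ∀ᶠ n : ℕ in atTop, Real.log n ^ p ≤ c * n := by
  filter_upwards [(isLittleO_log_natCast_pow p).def hc] with n hn
  rw [Real.norm_natCast] at hn
  exact (le_abs_self _).trans hn

/-- Iterated logarithms are negligible compared to logarithms. -/
theorem eventually_log_log_le (c : ℝ) {δ : ℝ} (hδ : 0 < δ) :
    ∀ᶠ n : ℕ in atTop, c * Real.log (Real.log n) + Real.log 2 ≤ δ * Real.log n := by
  have h1 : (fun x : ℝ => c * Real.log x) =o[atTop] (fun x : ℝ => x) :=
    Real.isLittleO_log_id_atTop.const_mul_left c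
  have h2 := (h1.comp_tendsto tendsto_log_natCast).def (half_pos hδ)
  filter_upwards [h2, tendsto_log_natCast.eventually_ge_atTop (Real.log 2 / (δ / 2)),
    tendsto_log_natCast.eventually_ge_atTop 0] with n hn hn2 hn0
  simp only [Function.comp_apply, Real.norm_eq_abs, abs_of_nonneg hn0] at hn
  rw [div_le_iff₀ (half_pos hδ)] at hn2
  have := le_abs_self (c * Real.log (Real.log n))
  linarith

/-- Breaker wins at `b₀` and Maker at `b₀ - 1` when this is positive. The shift by one is harmless
because `f` tends to infinity. -/
theorem isAsymptoticThresholdBias_of_forall {a k : ℕ → ℕ} (hk : ∀ n, 1 ≤ k n) {f : ℕ → ℝ}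
    (hf : Tendsto f atTop atTop)
    (hM : ∀ ε : ℝ, 0 < ε → ε < 1 → ∀ᶠ n : ℕ in atTop, ∀ b : ℕ, 1 ≤ b → (b : ℝ) ≤ (1 - ε) * f n →
      MakerWins (completeEdges n) (minDegreeSets n (k n)) (a n) b)
    (hB : ∀ ε : ℝ, 0 < ε → ε < 1 → ∀ᶠ n : ℕ in atTop, ∀ b : ℕ, 1 ≤ b → (1 + ε) * f n ≤ b →
      BreakerWins (completeEdges n) (minDegreeSets n (k n)) (a n) b) :
    IsAsymptoticThresholdBias a k f := by
  choose b₀ hb₀ using fun n => exists_isThresholdBias (X := completeEdges n) (a := a n)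
    (empty_notMem_minDegreeSets (n := n) (hk n))
  refine ⟨b₀, hb₀, ?_⟩
  rw [IsEquivalent, isLittleO_iff]
  intro c hc
  set ε : ℝ := min (c / 2) (1 / 2) with hε
  have hε0 : 0 < ε := lt_min (by positivity) (by norm_num)
  have hεc : ε ≤ c / 2 := min_le_left _ _
  have hε1 : ε < 1 := (min_le_right _ _).trans_lt (by norm_num)
  filter_upwards [hM ε hε0 hε1, hB ε hε0 hε1, hf.eventually_ge_atTop (2 / c),
    hf.eventually_ge_atTop 0] with n hMn hBn hfc hf0
  rw [div_le_iff₀ hc] at hfc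
  obtain ⟨h1, h2⟩ := hb₀ n
  have hlow : (1 - ε) * f n ≤ b₀ n := by
    by_contra! hlt
    exact (hMn _ h1 hlt.le).not_breakerWins ((h2 _ h1).2 le_rfl)
  have hup : (b₀ n : ℝ) ≤ (1 + ε) * f n + 1 := by
    by_contra! hlt
    have hpos : 0 ≤ (1 + ε) * f n := by positivity
    have hb1 : 1 < b₀ n := by
      have : (1 : ℝ) < b₀ n := by linarith
      exact_mod_cast this
    refine ((h2 (b₀ n - 1) (by omega)).1 (by omega)).not_breakerWins (hBn _ (by omega) ?_)
    rw [Nat.cast_sub h1, Nat.cast_one]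
    linarith
  have hεf : ε * f n ≤ c / 2 * f n := mul_le_mul_of_nonneg_right hεc hf0
  simp only [Pi.sub_apply, Real.norm_eq_abs]
  rw [abs_of_nonneg hf0, abs_le]
  constructor <;> linarith

/-- With `m = ⌊n / log n⌋`, both `m` and `b / m` are `o(n)`, and `log n - log m` is of order `log
log n`. The main term `β log m + b` is at most `β (a + log n)`. -/
theorem eventually_makerWins {a k : ℕ → ℕ} (ha : ∀ n, 1 ≤ a n)
    (hk : (fun n => (k n : ℝ)) =o[atTop] (fun n : ℕ => a n + Real.log n))
    (hkn : (fun n => (k n : ℝ)) =o[atTop] (fun n : ℕ => (n : ℝ))) {ε : ℝ} (hε0 : 0 < ε)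
    (hε1 : ε < 1) :
    ∀ᶠ n : ℕ in atTop, ∀ b : ℕ, 1 ≤ b → (b : ℝ) ≤ (1 - ε) * (a n * n / (a n + Real.log n)) →
      MakerWins (completeEdges n) (minDegreeSets n (k n)) (a n) b := by
  -- The error terms add up to at most `7δn`, well below `εn = 20δn`.
  have hδ : 0 < ε / 20 := by positivity
  generalize hδe : ε / 20 = δ at hδ
  filter_upwards [hk.def hδ, hkn.def hδ, eventually_log_pow_le 1 (half_pos hδ),
    eventually_log_pow_le 1 one_pos, eventually_log_log_le 1 hδ,
    tendsto_log_natCast.eventually_ge_atTop 1, tendsto_log_natCast.eventually_ge_atTop (1 / δ),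
    eventually_ge_atTop 1] with n h1 h2 h3 h4 h5 hl hlδ hn b hb hbf
  have : NeZero n := ⟨by omega⟩
  have hn0 : (0 : ℝ) < n := by exact_mod_cast hn
  have ha1 : (1 : ℝ) ≤ a n := by exact_mod_cast ha n
  have hb0 : (0 : ℝ) ≤ b := Nat.cast_nonneg b
  rw [Real.norm_natCast] at h1 h2
  rw [Real.norm_natCast] at h2
  rw [Real.norm_eq_abs, abs_of_nonneg (by linarith)] at h1
  rw [pow_one] at h3 h4
  rw [one_mul] at h4 h5
  generalize hℓ : Real.log n = ℓ at *
  have hℓ0 : 0 < ℓ := by linarith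
  have hL0 : 0 < (a n : ℝ) + ℓ := by linarith
  have hx1 : 1 ≤ (n : ℝ) / ℓ := by rwa [le_div_iff₀ hℓ0, one_mul]
  set m := ⌊(n : ℝ) / ℓ⌋₊ with hm
  have hm1 : 1 ≤ m := Nat.le_floor (by simpa using hx1)
  have hm1' : (1 : ℝ) ≤ m := by exact_mod_cast hm1
  have hmle : (m : ℝ) ≤ n / ℓ := Nat.floor_le (by positivity)
  have hmge : (n : ℝ) / ℓ ≤ 2 * m := by
    have := Nat.lt_floor_add_one ((n : ℝ) / ℓ)
    rw [← hm] at this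
    linarith
  have hmn : (m : ℝ) ≤ n := hmle.trans (div_le_self hn0.le hl)
  have hmδ : (m : ℝ) ≤ δ * n := by
    refine hmle.trans ?_
    rw [div_le_iff₀ hℓ0]
    rw [div_le_iff₀ hδ] at hlδ
    have := mul_le_mul_of_nonneg_right hlδ hn0.le
    linarith
  have hlogm : ℓ - Real.log m ≤ δ * ℓ := by
    have hle : Real.log ((n : ℝ) / ℓ) ≤ Real.log (2 * m) :=
      Real.log_le_log (by positivity) hmge
    rw [Real.log_div hn0.ne' hℓ0.ne', Real.log_mul two_ne_zero (by positivity), hℓ] at hle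
    linarith
  have hlogmn : Real.log m ≤ ℓ := by
    rw [← hℓ]
    exact Real.log_le_log (by linarith) hmn
  have ha0 : (0 : ℝ) < a n := by linarith
  obtain ⟨β, hβ⟩ : ∃ β : ℝ, β = b / a n := ⟨_, rfl⟩
  have hβ0 : 0 ≤ β := by rw [hβ]; positivity
  have hβa : β * a n = b := by rw [hβ]; field_simp
  have hβL : β * (a n + ℓ) ≤ (1 - ε) * n := by
    have h6 : b * (a n + ℓ) ≤ (1 - ε) * (a n * n) := by
      have := mul_le_mul_of_nonneg_right hbf hL0.le
      rwa [mul_assoc, div_mul_cancel₀ _ hL0.ne'] at this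
    rw [← hβa] at h6
    refine le_of_mul_le_mul_left ?_ ha0
    linarith
  have hβL' : β * (a n + ℓ) ≤ n := hβL.trans (by nlinarith)
  have hbn : (b : ℝ) ≤ n := by
    rw [← hβa]
    have := mul_nonneg hβ0 hℓ0.le
    linarith
  have hbm : (b : ℝ) / m ≤ δ * n := by
    rw [div_le_iff₀ (by linarith)]
    rw [div_le_iff₀ hℓ0] at hmge
    have h7 : (n : ℝ) ≤ 2 * m * (δ / 2 * n) := hmge.trans
      (mul_le_mul_of_nonneg_left h3 (by positivity))
    linarith
  refine makerWins_minDegree (ha n) hm1 (by exact_mod_cast hmn) hβ ?_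
  rw [hℓ]
  have e1 : β * k n ≤ δ * n := by
    have := mul_le_mul_of_nonneg_left h1 hβ0
    have := mul_le_mul_of_nonneg_left hβL' hδ.le
    linarith
  have e2 : β * (ℓ - Real.log m) ≤ δ * n := by
    have := mul_le_mul_of_nonneg_left hlogm hβ0
    have h8 := mul_le_mul_of_nonneg_left hβL' hδ.le
    have : 0 ≤ δ * (β * a n) := by positivity
    linarith
  have e3 : β * Real.log m + b ≤ (1 - ε) * n := by
    have := mul_le_mul_of_nonneg_left hlogmn hβ0
    linarith
  have e4 : ε * n = 20 * (δ * n) := by rw [← hδe]; ring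
  have e5 : 0 < δ * n := by positivity
  linarith

theorem eventually_breakerWins {a k : ℕ → ℕ} (ha : ∀ n, 1 ≤ a n) (hk : ∀ n, 1 ≤ k n) {ε : ℝ}
    (hε0 : 0 < ε) (hε1 : ε < 1) :
    ∀ᶠ n : ℕ in atTop, ∀ b : ℕ, (1 + ε) * (a n * n / (a n + Real.log n)) ≤ b →
      BreakerWins (completeEdges n) (minDegreeSets n (k n)) (a n) b := by
  have hδ : 0 < ε / 4 := by positivity
  generalize hδe : ε / 4 = δ at hδ
  obtain ⟨c, hc⟩ : ∃ c : ℝ, c = 1 / ε := ⟨_, rfl⟩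
  have hc0 : 0 < c := by rw [hc]; positivity
  have hcε : ε * c = 1 := by rw [hc]; field_simp
  filter_upwards [eventually_log_log_le 3 hδ, eventually_log_pow_le 3 one_pos,
    tendsto_log_natCast.eventually_ge_atTop 1, tendsto_log_natCast.eventually_ge_atTop (1 / δ),
    -- Chosen so that building the clique, at most `6a²q` edges per round, fits into `b`.
    tendsto_log_natCast.eventually_ge_atTop (6 * c * (c + 1)),
    eventually_ge_atTop 1] with n h1 h2 hl hlδ hlc hn b hbf
  have : NeZero n := ⟨by omega⟩
  have hn0 : (0 : ℝ) < n := by exact_mod_cast hn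
  have ha1 : (1 : ℝ) ≤ a n := by exact_mod_cast ha n
  have ha0 : (0 : ℝ) < a n := by linarith
  generalize hℓ : Real.log n = ℓ at *
  have hℓ0 : 0 < ℓ := by linarith
  have hL0 : 0 < (a n : ℝ) + ℓ := by linarith
  have hbL : (1 + ε) * (a n * n) ≤ b * (a n + ℓ) := by
    have := mul_le_mul_of_nonneg_right hbf hL0.le
    rwa [mul_assoc, div_mul_cancel₀ _ hL0.ne'] at this
  -- If `a ≥ log n / ε`, then `a + log n ≤ (1 + ε) a`, which forces `b ≥ n`.
  rcases le_or_gt (c * ℓ) (a n) with hac | hac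
  · refine breakerWins_minDegree_of_le (hk n) ?_
    have h6 : ℓ ≤ ε * a n := by
      have := mul_le_mul_of_nonneg_left hac hε0.le
      rwa [← mul_assoc, hcε, one_mul] at this
    have h7 : (a n + ℓ) * n ≤ (a n + ℓ) * b := by
      have := mul_le_mul_of_nonneg_right h6 hn0.le
      linarith
    exact_mod_cast le_of_mul_le_mul_left h7 hL0
  · rw [one_mul] at h2
    have hℓ3 : 0 < ℓ ^ 3 := by positivity
    -- The cube makes `a²q ≤ c²n / ℓ` negligible against `n`, while `log q` remains asymptotic to
    -- `ℓ`.
    set q := ⌊(n : ℝ) / ℓ ^ 3⌋₊ with hq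
    have hq1 : 1 ≤ q := Nat.le_floor (by
      rw [Nat.cast_one, le_div_iff₀ hℓ3, one_mul]
      exact h2)
    have hq1' : (1 : ℝ) ≤ q := by exact_mod_cast hq1
    have hqle : q * ℓ ^ 3 ≤ (n : ℝ) := by
      rw [← le_div_iff₀ hℓ3]
      exact Nat.floor_le (by positivity)
    have hqge : (n : ℝ) / ℓ ^ 3 ≤ ((q + 1 : ℕ) : ℝ) := by
      push_cast
      exact (Nat.lt_floor_add_one _).le
    have hlogq : ℓ - δ * ℓ ≤ Real.log ((q + 1 : ℕ) : ℝ) - Real.log 2 := by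
      have := Real.log_le_log (by positivity) hqge
      rw [Real.log_div hn0.ne' hℓ3.ne', Real.log_pow, hℓ] at this
      push_cast at this h1 ⊢
      linarith
    have hqℓ : a n * (q * ℓ ^ 2) ≤ c * n := by
      have h6 := mul_le_mul_of_nonneg_right hac.le (by positivity : (0 : ℝ) ≤ q * ℓ ^ 2)
      have h7 := mul_le_mul_of_nonneg_left hqle hc0.le
      linarith
    have haaq : (a n : ℝ) * (a n * q) * ℓ ≤ c * (c * n) := by
      have h6 := mul_le_mul_of_nonneg_right hac.le (by positivity : (0 : ℝ) ≤ a n * q * ℓ)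
      have h7 := mul_le_mul_of_nonneg_left hqℓ hc0.le
      linarith
    have haq : (a n : ℝ) ≤ a n * q := le_mul_of_one_le_right ha0.le hq1'
    have haaq1 : (a n : ℝ) * q ≤ a n * (a n * q) :=
      le_mul_of_one_le_left (by positivity) ha1
    have hδ1 : 0 ≤ 1 - δ := by rw [← hδe]; linarith
    refine breakerWins_minDegree (hk n) (ha n) hq1 ?_ ?_ ?_
    · have h6 : ((a n : ℝ) + 1) * (a n * q + a n + 1) ≤ 6 * (a n * (a n * q)) := by
        have := mul_le_mul (by linarith : (a n : ℝ) + 1 ≤ 2 * a n)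
          (by linarith : (a n : ℝ) * q + a n + 1 ≤ 3 * (a n * q)) (by positivity) (by positivity)
        linarith
      have h7 : (a n + ℓ) * (6 * (a n * (a n * q))) ≤ (a n + ℓ) * b := by
        have h8 : (a n : ℝ) + ℓ ≤ (c + 1) * ℓ := by linarith
        have h9 := mul_le_mul_of_nonneg_right h8
          (by positivity : (0 : ℝ) ≤ 6 * (a n * (a n * q)))
        have h10 := mul_le_mul_of_nonneg_left hqℓ (by positivity : 0 ≤ 6 * (c + 1) * a n)
        have h11 := mul_le_mul_of_nonneg_right hlc (by positivity : (0 : ℝ) ≤ a n * n)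
        have h12 : (0 : ℝ) ≤ ε * (a n * n) := by positivity
        have h13 : ℓ * ((a n + ℓ) * (6 * (a n * (a n * q)))) ≤ ℓ * ((a n + ℓ) * b) := by
          have h14 := mul_le_mul_of_nonneg_left h9 hℓ0.le
          have h15 : ℓ * (a n * n) ≤ ℓ * (b * (a n + ℓ)) :=
            mul_le_mul_of_nonneg_left (by linarith) hℓ0.le
          linarith
        exact le_of_mul_le_mul_left h13 hℓ0
      have h8 := h6.trans (le_of_mul_le_mul_left h7 hL0)
      exact_mod_cast h8
    · have h6 : (a n : ℝ) * q + 2 * (a n * (a n * q)) + (a n + 1) ≤ n := by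
        have h7 : ℓ * (5 * (a n * (a n * q))) ≤ ℓ * n := by
          have h8 : 5 * (c * c) ≤ ℓ := by
            have : 0 ≤ c * c := by positivity
            linarith
          have h9 := mul_le_mul_of_nonneg_right h8 hn0.le
          linarith
        have h8 := le_of_mul_le_mul_left h7 hℓ0
        linarith
      exact_mod_cast h6
    · have h6 : (b : ℝ) / a n * (ℓ - δ * ℓ) ≤
          b / a n * (Real.log ((q + 1 : ℕ) : ℝ) - Real.log 2) :=
        mul_le_mul_of_nonneg_left hlogq (by positivity)
      have h7 : (1 + ε) * n ≤ b / a n * (a n + ℓ) := by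
        rw [div_mul_eq_mul_div, le_div_iff₀ ha0]
        linarith
      have h8 : (b : ℝ) = b / a n * a n := by field_simp
      have h9 : (1 - δ) * (b / a n * (a n + ℓ)) ≤ b + b / a n * (ℓ - δ * ℓ) := by
        have : 0 ≤ δ * b := by positivity
        have h10 : (1 - δ) * (b / a n * (a n + ℓ)) = (1 - δ) * b + b / a n * (ℓ - δ * ℓ) := by
          conv_rhs => rw [h8]
          field_simp
        linarith
      have h10 := mul_le_mul_of_nonneg_left h7 hδ1
      have hqδ : (q : ℝ) ≤ δ * n := by
        have h11 : 1 ≤ δ * ℓ := by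
          rw [div_le_iff₀ hδ] at hlδ
          linarith
        have h12 : ℓ ≤ ℓ ^ 3 := le_self_pow₀ hl (by norm_num)
        have h13 : (q : ℝ) * ℓ ≤ n :=
          (mul_le_mul_of_nonneg_left h12 (by positivity)).trans hqle
        have h14 := mul_le_mul_of_nonneg_left h13 hδ.le
        have h15 := mul_le_mul_of_nonneg_left h11 (by positivity : (0 : ℝ) ≤ q)
        linarith
      have h16 : n + δ * n ≤ (1 - δ) * ((1 + ε) * n) := by
        have h17 : 1 + δ ≤ (1 - δ) * (1 + ε) := by
          rw [← hδe]
          nlinarith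
        have := mul_le_mul_of_nonneg_right h17 hn0.le
        linarith
      linarith

/-- Eventually `a + log n ≤ 2 a log n`, so the quotient is at least `n / (2 log n)`. -/
theorem tendsto_mul_div_add_log {a : ℕ → ℕ} (ha : ∀ n, 1 ≤ a n) :
    Tendsto (fun n : ℕ => (a n : ℝ) * n / (a n + Real.log n)) atTop atTop := by
  rw [tendsto_atTop]
  intro x
  have hx : 0 < 1 / (2 * max x 1) := by positivity
  filter_upwards [eventually_log_pow_le 1 hx,
    tendsto_log_natCast.eventually_ge_atTop 1] with n h1 hl
  have ha1 : (1 : ℝ) ≤ a n := by exact_mod_cast ha n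
  have hx1 : 1 ≤ max x 1 := le_max_right _ _
  refine (le_max_left x 1).trans ?_
  rw [pow_one, one_div_mul_eq_div, le_div_iff₀ (by positivity)] at h1
  generalize max x 1 = y at *
  rw [le_div_iff₀ (by linarith)]
  have h2 : (a n : ℝ) + Real.log n ≤ a n * (2 * Real.log n) := by nlinarith
  have h3 := mul_le_mul_of_nonneg_left h2 (by linarith : 0 ≤ y)
  have h4 := mul_le_mul_of_nonneg_left h1 (by linarith : (0 : ℝ) ≤ a n)
  linarith

/-- After squaring, this is `log³ n = o(n)`. -/
theorem isLittleO_log_of_sqrt_isBigO {g : ℕ → ℝ}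
    (h : (fun n : ℕ => Real.sqrt ((n : ℝ) / Real.log n)) =O[atTop] g) :
    (fun n : ℕ => Real.log n) =o[atTop] g := by
  refine IsLittleO.trans_isBigO ?_ h
  rw [isLittleO_iff]
  intro c hc
  filter_upwards [eventually_log_pow_le 3 (sq_pos_of_pos hc),
    tendsto_log_natCast.eventually_ge_atTop 1] with n h1 hl
  have hℓ0 : 0 < Real.log n := by linarith
  rw [Real.norm_eq_abs, Real.norm_eq_abs, abs_of_pos hℓ0, abs_of_nonneg (Real.sqrt_nonneg _),
    ← div_le_iff₀' hc]
  refine Real.le_sqrt_of_sq_le ?_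
  rw [div_pow, div_le_div_iff₀ (by positivity) hℓ0]
  linarith

end Asymptotic

end MakerBreaker

/-! ### The two regimes -/

theorem mainTheorem2 (a k : ℕ → ℕ) (ha : ∀ n, 1 ≤ a n) (hk : ∀ n, 1 ≤ k n) :
    ((fun n => (a n : ℝ)) =o[atTop] (fun n : ℕ => Real.sqrt ((n : ℝ) / Real.log n)) →
      (fun n => (k n : ℝ)) =o[atTop] (fun n : ℕ => Real.log n) →
      MakerBreaker.IsAsymptoticThresholdBias a k
        (fun n => (a n : ℝ) * n / (a n + Real.log n))) ∧
    ((fun n : ℕ => Real.sqrt ((n : ℝ) / Real.log n)) =O[atTop] (fun n => (a n : ℝ)) →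
      (fun n => (k n : ℝ)) =o[atTop] (fun n => (a n : ℝ)) →
      (fun n => (k n : ℝ)) =o[atTop] (fun n : ℕ => (n : ℝ)) →
      MakerBreaker.IsAsymptoticThresholdBias a k (fun n => (n : ℝ))) := by
  have hlog0 (n : ℕ) : 0 ≤ Real.log n := Real.log_natCast_nonneg n
  constructor
  · intro _ hkl
    refine MakerBreaker.isAsymptoticThresholdBias_of_forall hk
      (MakerBreaker.tendsto_mul_div_add_log ha) (fun ε hε0 hε1 => ?_) (fun ε hε0 hε1 => ?_)
    · refine MakerBreaker.eventually_makerWins ha ?_ ?_ hε0 hε1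
      · refine hkl.trans_le fun n => ?_
        rw [Real.norm_of_nonneg (hlog0 n), Real.norm_of_nonneg (by have := hlog0 n; positivity)]
        linarith [(Nat.cast_nonneg (a n) : (0 : ℝ) ≤ a n)]
      · exact hkl.trans (by simpa using MakerBreaker.isLittleO_log_natCast_pow 1)
    · filter_upwards [MakerBreaker.eventually_breakerWins ha hk hε0 hε1] with n hn b _ hb
      exact hn b hb
  · intro hsqrt hka hkn
    have hla := MakerBreaker.isLittleO_log_of_sqrt_isBigO hsqrt
    refine MakerBreaker.isAsymptoticThresholdBias_of_forall hk tendsto_natCast_atTop_atTop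
      (fun ε hε0 hε1 => ?_) (fun ε hε0 hε1 => ?_)
    · have hka' : (fun n => (k n : ℝ)) =o[atTop] (fun n : ℕ => a n + Real.log n) := by
        refine hka.trans_le fun n => ?_
        rw [Real.norm_natCast, Real.norm_of_nonneg (by have := hlog0 n; positivity)]
        linarith [hlog0 n]
      -- Half of `ε` is spent on replacing `a n / (a + log n)` by `n`, using `log n ≤ (ε / 2) a`.
      filter_upwards [MakerBreaker.eventually_makerWins ha hka' hkn (half_pos hε0)
        (by linarith : ε / 2 < 1), hla.def (half_pos hε0)] with n hn hl b hb hbn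
      refine hn b hb (hbn.trans ?_)
      rw [Real.norm_of_nonneg (hlog0 n), Real.norm_natCast] at hl
      have ha1 : (1 : ℝ) ≤ a n := by exact_mod_cast ha n
      have hL : 0 < (a n : ℝ) + Real.log n := by linarith [hlog0 n]
      rw [← mul_div_assoc, le_div_iff₀ hL]
      have h1 : (1 - ε) * (a n + Real.log n) ≤ (1 - ε / 2) * a n := by
        have h2 := mul_le_mul_of_nonneg_left hl (by linarith : 0 ≤ 1 - ε)
        have h3 : 0 ≤ ε * ε * a n := by positivity
        linarith
      have h4 := mul_le_mul_of_nonneg_right h1 (Nat.cast_nonneg n : (0 : ℝ) ≤ n)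
      linarith
    · filter_upwards [eventually_ge_atTop 1] with n hn b _ hb
      have : NeZero n := ⟨by omega⟩
      refine MakerBreaker.breakerWins_minDegree_of_le (hk n) ?_
      have h1 : (n : ℝ) ≤ b := by
        have : (0 : ℝ) ≤ ε * n := by positivity
        linarith
      exact_mod_cast h1
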